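/- Let $L,\eta,\kappa,\beta,\tau>0$ and let $m,p,\delta\in W^{1,\infty}(0,L)$ (continuous representatives) be positive at every point of $[0,L]$. Let $$\mathcal H=H^1_0(0,L)\times L^2(0,L)\times L^2(0,L)\times L^2(0,L)$$ (real- or complex-valued functions) and let $\mathcal A$ be the operator in $\mathcal H$ given by $$\mathcal A(u,w,\theta,q)=\Big(w,\ \tfrac1m\big(p\,u_x+2\delta\,w_x-\eta\,\theta\big)_x,\ -\kappa\,q_x-\eta\,w_x,\ -\tfrac1\tau(\kappa\,\theta_x+\beta\,q)\Big)$$ on the domain $$D(\mathcal A)=\{(u,w,\theta,q)\in\mathcal H:\ w\in H^1_0(0,L),\ p\,u_x+2\delta\,w_x\in H^1(0,L),\ \theta\in H^1_0(0,L),\ q\in H^1(0,L)\}.$$ Thus $\frac{dU}{dt}=\mathcal A U$ with $U=(u,u_t,\theta,q)$ is the system $$m\,u_{tt}-(p\,u_x+2\delta\,u_{xt})_x+\eta\,\theta_x=0,\qquad \theta_t+\kappa\,q_x+\eta\,u_{xt}=0,\qquad \tau\,q_t+\beta\,q+\kappa\,\theta_x=0$$ with boundary conditions $u=\theta=0$ at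 $x=0$ and $x=L$. For $n\ge1$ put $$\mathcal E_n(t)=\frac12\Big[\int_0^L p\,|\partial_t^{n-1}u_x|^2\,dx+\int_0^L m\,|\partial_t^{n-1}u_t|^2\,dx+\int_0^L|\partial_t^{n-1}\theta|^2\,dx+\tau\int_0^L|\partial_t^{n-1}q|^2\,dx\Big].$$ Then there is a constant $C>0$, depending only on $L,m,p,\delta,\eta,\kappa,\beta,\tau$, such that for every integer $n\ge1$ and every $U_0\in D(\mathcal A^{n+1})$ the problem $\frac{dU}{dt}=\mathcal A U$, $U(0)=U_0$, has a unique strong solution $U\in C^1([0,\infty);\mathcal H)\cap C([0,\infty);D(\mathcal A))$, this solution belongs to $C^{n+1}([0,\infty);\mathcal H)$, and $$\mathcal E_n(t)\le\frac{C\,[\mathcal E_n(0)+\mathcal E_{n+1}(0)]}{t}\qquad\text{for all } t>0.$$ -/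

import Mathlib

noncomputable section

open MeasureTheory Set
open scoped ContDiff ENNReal

namespace Cattaneo

/-- `g` is the weak derivative of `f` on the interval `(0, L)`: integration by parts holds against
every test function in `C_c^∞(0, L)`. -/
def HasWeakDeriv {E : Type*} [NormedAddCommGroup E] [NormedSpace ℝ E]
    (L : ℝ) (f g : ℝ → E) : Prop :=
  ∀ φ : ℝ → ℝ, ContDiff ℝ ∞ φ → HasCompactSupport φ → tsupport φ ⊆ Ioo 0 L →
    ∫ x in Ioo 0 L, deriv φ x • f x = - ∫ x in Ioo 0 L, φ x • g x

/-- `f ∈ W^{1,∞}(0, L)`, given by its continuous representative on `[0, L]`. -/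
def IsW1Inf (L : ℝ) (f : ℝ → ℝ) : Prop :=
  ContinuousOn f (Icc 0 L) ∧
    ∃ g : ℝ → ℝ, MemLp g ∞ (volume.restrict (Ioo 0 L)) ∧ HasWeakDeriv L f g

/-- The Lebesgue space `L²(0, L)`. -/
abbrev L2 (𝕜 : Type*) [RCLike 𝕜] (L : ℝ) : Type _ :=
  Lp 𝕜 2 (volume.restrict (Ioo 0 L))

/-- `f` vanishes at both ends of `[0, L]`, in the sense that it has a representative that is
continuous on `[0, L]` and vanishes at `0` and at `L`. -/
def VanishesAtEnds {𝕜 : Type*} [RCLike 𝕜] {L : ℝ} (f : L2 𝕜 L) : Prop :=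
  ∃ r : ℝ → 𝕜, ContinuousOn r (Icc 0 L) ∧ r 0 = 0 ∧ r L = 0 ∧
    ∀ᵐ x ∂(volume.restrict (Ioo 0 L)), f x = r x

section
variable {𝕜 : Type*} [RCLike 𝕜] {L : ℝ}

theorem integrable_smul_test (f : L2 𝕜 L) {φ : ℝ → ℝ} (hφ : Continuous φ)
    (hc : HasCompactSupport φ) :
    Integrable (fun x => φ x • f x) (volume.restrict (Ioo 0 L)) := by
  have hf : Integrable f (volume.restrict (Ioo 0 L)) :=
    (Lp.memLp f).integrable (by norm_num)
  obtain ⟨K, hK⟩ := hc.exists_bound_of_continuous hφ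
  exact hf.bdd_smul K hφ.aestronglyMeasurable (Filter.Eventually.of_forall hK)

theorem HasWeakDeriv.add_L2 {f g f' g' : L2 𝕜 L} (h : HasWeakDeriv L f g)
    (h' : HasWeakDeriv L f' g') :
    HasWeakDeriv L (f + f' : L2 𝕜 L) (g + g' : L2 𝕜 L) := by
  intro φ hφ hc hs
  have hd : Continuous (deriv φ) := hφ.continuous_deriv (by simp)
  have e1 : ∫ x in Ioo 0 L, deriv φ x • (f + f' : L2 𝕜 L) x
      = ∫ x in Ioo 0 L, (deriv φ x • f x + deriv φ x • f' x) := by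
    refine integral_congr_ae ?_
    filter_upwards [Lp.coeFn_add f f'] with x hx
    rw [hx, Pi.add_apply, smul_add]
  have e2 : ∫ x in Ioo 0 L, φ x • (g + g' : L2 𝕜 L) x
      = ∫ x in Ioo 0 L, (φ x • g x + φ x • g' x) := by
    refine integral_congr_ae ?_
    filter_upwards [Lp.coeFn_add g g'] with x hx
    rw [hx, Pi.add_apply, smul_add]
  rw [e1, e2, integral_add (integrable_smul_test f hd hc.deriv)
    (integrable_smul_test f' hd hc.deriv),
    integral_add (integrable_smul_test g hφ.continuous hc)
    (integrable_smul_test g' hφ.continuous hc), h φ hφ hc hs, h' φ hφ hc hs, neg_add]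

theorem HasWeakDeriv.smul_L2 {f g : L2 𝕜 L} (c : 𝕜) (h : HasWeakDeriv L f g) :
    HasWeakDeriv L (c • f : L2 𝕜 L) (c • g : L2 𝕜 L) := by
  intro φ hφ hc hs
  have e1 : ∫ x in Ioo 0 L, deriv φ x • (c • f : L2 𝕜 L) x
      = ∫ x in Ioo 0 L, c • (deriv φ x • f x) := by
    refine integral_congr_ae ?_
    filter_upwards [Lp.coeFn_smul c f] with x hx
    rw [hx, Pi.smul_apply, smul_comm]
  have e2 : ∫ x in Ioo 0 L, φ x • (c • g : L2 𝕜 L) x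
      = ∫ x in Ioo 0 L, c • (φ x • g x) := by
    refine integral_congr_ae ?_
    filter_upwards [Lp.coeFn_smul c g] with x hx
    rw [hx, Pi.smul_apply, smul_comm]
  rw [e1, e2, integral_smul, integral_smul, h φ hφ hc hs, smul_neg]

theorem HasWeakDeriv.zero_L2 :
    HasWeakDeriv L (0 : L2 𝕜 L) (0 : L2 𝕜 L) := by
  intro φ hφ hc hs
  have e : ∀ ψ : ℝ → ℝ, ∫ x in Ioo 0 L, ψ x • (0 : L2 𝕜 L) x = 0 := by
    intro ψ
    refine integral_eq_zero_of_ae ?_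
    filter_upwards [Lp.coeFn_zero 𝕜 2 (volume.restrict (Ioo 0 L))] with x hx
    rw [hx]
    simp
  rw [e, e, neg_zero]

end

/-- The Sobolev space `H¹₀(0, L)`. An element is stored as the pair `(u, u_x)` of the function and
its weak derivative, both in `L²(0, L)`, so that the norm inherited from `L² × L²` is (equivalent
to) the `H¹` norm; the boundary condition is `u(0) = u(L) = 0`. -/
def H10 (𝕜 : Type*) [RCLike 𝕜] (L : ℝ) : Submodule 𝕜 (L2 𝕜 L × L2 𝕜 L) where
  carrier := {v | HasWeakDeriv L v.1 v.2 ∧ VanishesAtEnds v.1}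
  add_mem' := by
    rintro v v' ⟨h, r, hr, hr0, hrL, hvr⟩ ⟨h', r', hr', hr0', hrL', hvr'⟩
    refine ⟨h.add_L2 h', r + r', hr.add hr', by simp [hr0, hr0'], by simp [hrL, hrL'], ?_⟩
    filter_upwards [Lp.coeFn_add v.1 v'.1, hvr, hvr'] with x hx h1 h2
    rw [Prod.fst_add, hx, Pi.add_apply, Pi.add_apply, h1, h2]
  zero_mem' := by
    refine ⟨HasWeakDeriv.zero_L2, 0, continuousOn_const, rfl, rfl, ?_⟩
    exact Lp.coeFn_zero 𝕜 2 (volume.restrict (Ioo 0 L))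
  smul_mem' := by
    rintro c v ⟨h, r, hr, hr0, hrL, hvr⟩
    refine ⟨h.smul_L2 c, fun x => c • r x, hr.const_smul c, by simp [hr0], by simp [hrL], ?_⟩
    filter_upwards [Lp.coeFn_smul c v.1, hvr] with x hx h1
    rw [Prod.smul_fst, hx, Pi.smul_apply, h1]

/-- The function `u` underlying an element of `H¹₀(0, L)`. -/
def fn {𝕜 : Type*} [RCLike 𝕜] {L : ℝ} (u : H10 𝕜 L) : L2 𝕜 L := u.1.1

/-- The weak derivative `u_x` of an element of `H¹₀(0, L)`. -/
def dx {𝕜 : Type*} [RCLike 𝕜] {L : ℝ} (u : H10 𝕜 L) : L2 𝕜 L := u.1.2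

/-- The phase space `ℋ = H¹₀ × L² × L² × L²` of states `(u, w, θ, q)`, with the product topology
(which is that of the energy norm). -/
abbrev Phase (𝕜 : Type*) [RCLike 𝕜] (L : ℝ) : Type _ :=
  H10 𝕜 L × L2 𝕜 L × L2 𝕜 L × L2 𝕜 L

/-- The parameters of the system: length of the structure, coefficient functions and constants. -/
structure Params where
  L : ℝ
  m : ℝ → ℝ
  p : ℝ → ℝ
  δ : ℝ → ℝ
  η : ℝ
  κ : ℝ
  β : ℝ
  τ : ℝ

/-- The standing assumptions on the parameters. -/
structure Params.Admissible (P : Params) : Prop where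
  L_pos : 0 < P.L
  m_reg : IsW1Inf P.L P.m
  p_reg : IsW1Inf P.L P.p
  δ_reg : IsW1Inf P.L P.δ
  m_pos : ∀ x ∈ Icc 0 P.L, 0 < P.m x
  p_pos : ∀ x ∈ Icc 0 P.L, 0 < P.p x
  δ_pos : ∀ x ∈ Icc 0 P.L, 0 < P.δ x
  η_pos : 0 < P.η
  κ_pos : 0 < P.κ
  β_pos : 0 < P.β
  τ_pos : 0 < P.τ

/-- The graph of the operator `𝒜` with clamped ends and temperature zero at both ends:
`IsImage P U F` says that `U = (u, w, θ, q)` lies in `D(𝒜)`, that is `w, θ ∈ H¹₀`,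
`p u_x + 2 δ w_x ∈ H¹` and `q ∈ H¹`, and that `F = 𝒜 U`, where
`𝒜 U = (w, (p u_x + 2 δ w_x - η θ)_x / m, - κ q_x - η w_x, - (κ θ_x + β q) / τ)`. -/
def IsImage {𝕜 : Type*} [RCLike 𝕜] (P : Params) (U F : Phase 𝕜 P.L) : Prop :=
  match U, F with
  | (u, w, θ, q), (f₁, f₂, f₃, f₄) =>
    ∃ w' θ' : H10 𝕜 P.L, ∃ σx qx : L2 𝕜 P.L,
      fn w' = w ∧ fn θ' = θ ∧
      HasWeakDeriv P.L
        (fun x => (P.p x : 𝕜) * dx u x + 2 * (P.δ x : 𝕜) * dx w' x) σx ∧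
      HasWeakDeriv P.L q qx ∧
      f₁ = w' ∧
      (∀ᵐ x ∂(volume.restrict (Ioo 0 P.L)),
        f₂ x = (P.m x : 𝕜)⁻¹ * (σx x - (P.η : 𝕜) * dx θ' x)) ∧
      f₃ = - (P.κ : 𝕜) • qx - (P.η : 𝕜) • dx w' ∧
      f₄ = - (P.τ : 𝕜)⁻¹ • ((P.κ : 𝕜) • dx θ' + (P.β : 𝕜) • q)

/-- `MemDomPow P k U` says that `U ∈ D(𝒜ᵏ)`. -/
def MemDomPow {𝕜 : Type*} [RCLike 𝕜] (P : Params) : ℕ → Phase 𝕜 P.L → Prop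
  | 0, _ => True
  | k + 1, U => ∃ F : Phase 𝕜 P.L, IsImage P U F ∧ MemDomPow P k F

/-- `U` (restricted to `[0, ∞)`) is a strong solution of `dU/dt = 𝒜 U`, `U(0) = U₀`: it belongs to
`C¹([0, ∞); ℋ)`, takes values in `D(𝒜)` and satisfies the equation. Since `𝒜 U = dU/dt` is
continuous in `ℋ`, it also belongs to `C([0, ∞); D(𝒜))`. -/
structure IsStrongSolution {𝕜 : Type*} [RCLike 𝕜] (P : Params) (U₀ : Phase 𝕜 P.L)
    (U : ℝ → Phase 𝕜 P.L) : Prop where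
  init : U 0 = U₀
  contDiffOn : ContDiffOn ℝ 1 U (Ici 0)
  eqn : ∀ t, 0 ≤ t → IsImage P (U t) (derivWithin U (Ici 0) t)

/-- The quadratic energy of a state
`½ (∫ p |u_x|² + ∫ m |w|² + ∫ |θ|² + τ ∫ |q|²)`. -/
def stateEnergy {𝕜 : Type*} [RCLike 𝕜] (P : Params) (V : Phase 𝕜 P.L) : ℝ :=
  match V with
  | (u, w, θ, q) =>
    (1 / 2) * ((∫ x in Ioo 0 P.L, P.p x * ‖dx u x‖ ^ 2)
      + (∫ x in Ioo 0 P.L, P.m x * ‖w x‖ ^ 2)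
      + (∫ x in Ioo 0 P.L, ‖θ x‖ ^ 2)
      + P.τ * ∫ x in Ioo 0 P.L, ‖q x‖ ^ 2)

/-- The energy of order `n ≥ 1` of `U = (u, u_t, θ, q)` at time `t`: the quadratic energy of the
time derivative of order `n - 1` (one-sided at `t = 0`), so that the energy of order one contains
no additional time derivative and the energy of order two contains one. -/
def energy {𝕜 : Type*} [RCLike 𝕜] (P : Params) (n : ℕ) (U : ℝ → Phase 𝕜 P.L) (t : ℝ) : ℝ :=
  stateEnergy P (iteratedDerivWithin (n - 1) U (Ici 0) t)

end Cattaneo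

end

/-! The energy norm makes the phase space, over the real scalars, isomorphic to a Hilbert space in
which `𝒜` is dissipative. Testing the momentum equation with `w` and the heat equation with `θ`, and
pairing the flux equation with `q`, makes all coupling terms cancel and gives the dissipation `2 ∫ δ
|w_x|² + β ‖q‖²` (`inner_energyMap_of_isImage`). The resolvent equation `l U - 𝒜 U = F` reduces,
after elimination of `u` and `q`, to a coercive problem for `(w, θ)` solved by Lax–Milgram
(`exists_isImage_resolvent`). Hence `𝒜` is maximal dissipative, and the Yosida approximation yields
a contraction semigroup (`exists_semigroup_of_embedding`); dissipativity also gives uniqueness.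

The dissipation of a state sees only `w_x` and `q`. Adding that of its time derivative brings in
`w_tx` and `q_t`, and this is enough for the whole energy: the flux law bounds `θ_x` by `q_t` and
`q`, and the momentum equation tested with `u` bounds `u_x` by `w_x`, `w_t` and `θ_x`
(`exists_energy_le_dissipation`). So the energy is at most a constant times the decay rate of the
sum of the energies of the state and of its derivative. It is therefore integrable in time, and
being nonincreasing it is `O(1/t)` (`mul_norm_sq_le_of_dissipation`).

For order `n` the same estimate is applied to the orbit of `𝒜ⁿ⁻¹ U₀`, which lies in the domain of
`𝒜²`; the constant does not depend on `n`. -/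

noncomputable section

open MeasureTheory Set
open scoped ContDiff ENNReal

namespace Cattaneo

open Filter Topology

/-! ### Generation of semigroups by maximal dissipative operators in Hilbert space -/

section Semigroup

variable {H : Type*} [NormedAddCommGroup H] [InnerProductSpace ℝ H]

/-- A differentiable curve on `[0, ∞)` whose velocity never points outwards has nonincreasing
norm. -/
theorem norm_sq_antitoneOn {f f' : ℝ → H}
    (hf : ∀ t, 0 ≤ t → HasDerivWithinAt f (f' t) (Ici 0) t)
    (hd : ∀ t, 0 ≤ t → inner ℝ (f t) (f' t) ≤ 0) :
    AntitoneOn (fun t => ‖f t‖ ^ 2) (Ici 0) := by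
  have hder : ∀ t, 0 ≤ t → HasDerivWithinAt (fun t => ‖f t‖ ^ 2) (2 * inner ℝ (f t) (f' t))
      (Ici 0) t := fun t ht => (hf t ht).norm_sq
  refine antitoneOn_of_hasDerivWithinAt_nonpos (convex_Ici 0)
    (fun t ht => (hder t ht).continuousWithinAt) (f' := fun t => 2 * inner ℝ (f t) (f' t)) ?_ ?_
  · intro t ht
    exact (hder t (interior_subset ht)).mono interior_subset
  · intro t ht
    have := hd t (interior_subset ht)
    linarith

/-- A linear subspace `A` of `H × H` is the graph of a maximal dissipative operator: it is
single-valued and dissipative, and `l - A` is onto for all `l > 0`. -/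
structure IsMaxDissipative (A : Submodule ℝ (H × H)) : Prop where
  dissip : ∀ z ∈ A, inner ℝ z.1 z.2 ≤ 0
  single : ∀ y, (0, y) ∈ A → y = 0
  surj : ∀ l : ℝ, 0 < l → ∀ f : H, ∃ z ∈ A, l • z.1 - z.2 = f

/-- `R` is the inverse of `l - A`. -/
structure IsResolvent (A : Submodule ℝ (H × H)) (l : ℝ) (R : H →L[ℝ] H) : Prop where
  mem : ∀ f, (R f, l • R f - f) ∈ A
  left_inv : ∀ x y, (x, y) ∈ A → R (l • x - y) = x
  bound : ∀ f, l * ‖R f‖ ≤ ‖f‖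

variable {A : Submodule ℝ (H × H)}

/-- Dissipativity gives `l ‖x‖² ≤ ⟪x, l x - y⟫`, and Cauchy–Schwarz does the rest. For `l > 0` this
is both injectivity of `l - A` and the resolvent bound. -/
theorem IsMaxDissipative.mul_norm_le (hA : IsMaxDissipative A) {l : ℝ} {x y : H}
    (h : (x, y) ∈ A) : l * ‖x‖ ≤ ‖l • x - y‖ := by
  have h1 : l * ‖x‖ ^ 2 ≤ inner ℝ x (l • x - y) := by
    rw [inner_sub_right, inner_smul_right, real_inner_self_eq_norm_sq]
    have := hA.dissip _ h
    simp only at this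
    linarith
  have h2 := h1.trans (real_inner_le_norm x (l • x - y))
  rcases eq_or_ne x 0 with rfl | hx
  · simp
  · have : 0 < ‖x‖ := norm_pos_iff.mpr hx
    nlinarith

theorem IsMaxDissipative.exists_resolvent (hA : IsMaxDissipative A) {l : ℝ} (hl : 0 < l) :
    ∃ R : H →L[ℝ] H, IsResolvent A l R := by
  have huniq : ∀ x y x' y', (x, y) ∈ A → (x', y') ∈ A → l • x - y = l • x' - y' → x = x' := by
    intro x y x' y' h h' he
    have h3 := hA.mul_norm_le (l := l) (x := x - x') (y := y - y') (A.sub_mem h h')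
    have h4 : l • (x - x') - (y - y') = 0 := by
      rw [smul_sub, sub_sub_sub_comm, he, sub_self]
    rw [h4, norm_zero] at h3
    have : ‖x - x'‖ ≤ 0 := by
      by_contra hc
      push Not at hc
      nlinarith
    exact sub_eq_zero.mp (norm_le_zero_iff.mp this)
  choose z hz hzf using hA.surj l hl
  have hz2 : ∀ f, (z f).2 = l • (z f).1 - f := fun f => by
    rw [eq_sub_iff_add_eq, ← eq_sub_iff_add_eq', hzf]
  have key : ∀ f x y, (x, y) ∈ A → l • x - y = f → (z f).1 = x := fun f x y hxy he =>
    huniq _ (z f).2 _ y (hz f) hxy (by rw [hzf, he])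
  let R : H →ₗ[ℝ] H :=
    { toFun := fun f => (z f).1
      map_add' := fun f g => key _ _ ((z f).2 + (z g).2) (A.add_mem (hz f) (hz g)) (by
        rw [smul_add, add_sub_add_comm, hzf, hzf])
      map_smul' := fun c f => key _ _ (c • (z f).2) (A.smul_mem c (hz f)) (by
        rw [RingHom.id_apply, smul_comm, ← smul_sub, hzf]) }
  have hb : ∀ f, l * ‖R f‖ ≤ ‖f‖ := fun f => by
    have := hA.mul_norm_le (l := l) (hz f)
    rwa [hzf] at this
  refine ⟨R.mkContinuous l⁻¹ fun f => ?_, ?_, ?_, ?_⟩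
  · rw [inv_mul_eq_div, le_div_iff₀ hl, mul_comm]
    exact hb f
  · intro f
    have := hz f
    have e : z f = ((z f).1, l • (z f).1 - f) := by rw [← hz2]
    rw [e] at this
    exact this
  · intro x y h
    exact key _ x y h rfl
  · exact hb

/-- The domain of a maximal dissipative operator is dense. -/
theorem IsMaxDissipative.dense_dom [CompleteSpace H] (hA : IsMaxDissipative A) :
    Dense {x : H | ∃ y, (x, y) ∈ A} := by
  let D : Submodule ℝ H := A.map (LinearMap.fst ℝ H H)
  have hD : {x : H | ∃ y, (x, y) ∈ A} = (D : Set H) := by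
    ext x
    simp [D]
  rw [hD, Submodule.dense_iff_topologicalClosure_eq_top, Submodule.topologicalClosure_eq_top_iff,
    Submodule.eq_bot_iff]
  intro f hf
  -- Write `f = x - y` with `y = A x`. Since `f` is orthogonal to `x`, `‖x‖² = ⟪x, y⟫ ≤ 0`, so `x =
  -- 0` and then `f = 0`.
  obtain ⟨⟨x, y⟩, hz, hxy⟩ := hA.surj 1 one_pos f
  rw [Submodule.mem_orthogonal] at hf
  have h0 := hf x ⟨(x, y), hz, rfl⟩
  simp only [one_smul] at hxy
  rw [← hxy, inner_sub_right, real_inner_self_eq_norm_sq] at h0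
  have h1 := hA.dissip _ hz
  simp only at h1
  have hx : x = 0 := by
    have : ‖x‖ ^ 2 ≤ 0 := by linarith
    exact norm_eq_zero.mp (pow_eq_zero_iff two_ne_zero |>.mp (le_antisymm this (by positivity)))
  subst hx
  rw [← hxy, hA.single y hz, sub_zero]

theorem IsResolvent.map_mem {l : ℝ} {R : H →L[ℝ] H} (hR : IsResolvent A l R) {x y : H}
    (h : (x, y) ∈ A) : (R x, R y) ∈ A := by
  have h1 := hR.left_inv x y h
  rw [map_sub, map_smul] at h1
  have h2 := hR.mem x
  have h3 : l • R x - x = R y := by rw [sub_eq_iff_eq_add, ← sub_eq_iff_eq_add', h1]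
  rwa [h3] at h2

/-- `R` maps the graph of `A` to itself, so `(k - A) R Q f = R (k - A) Q f = R f`; now apply `Q`. -/
theorem IsResolvent.commute {l k : ℝ} {R Q : H →L[ℝ] H} (hR : IsResolvent A l R)
    (hQ : IsResolvent A k Q) : Commute R Q := by
  ext f
  have h1 := hQ.left_inv _ _ (hR.map_mem (hQ.mem f))
  rw [← map_smul, ← map_sub, sub_sub_cancel] at h1
  exact h1.symm

/-- The Yosida approximation of `A` built from the resolvent `R` at `l`. -/
def yosida (l : ℝ) (R : H →L[ℝ] H) : H →L[ℝ] H := l • (l • R - 1)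

theorem yosida_apply_of_mem {l : ℝ} {R : H →L[ℝ] H} (hR : IsResolvent A l R) {x y : H}
    (h : (x, y) ∈ A) : yosida l R x = l • R y := by
  have h1 := hR.left_inv x y h
  rw [map_sub, map_smul] at h1
  have h2 : l • R x - x = R y := by rw [sub_eq_iff_eq_add, ← sub_eq_iff_eq_add', h1]
  simp [yosida, h2]

/-- Since `l R` is a contraction, `⟪x, l R x⟫ ≤ ‖x‖²`. -/
theorem inner_yosida_nonpos {l : ℝ} (hl : 0 < l) {R : H →L[ℝ] H} (hR : IsResolvent A l R)
    (x : H) : inner ℝ x (yosida l R x) ≤ 0 := by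
  have h1 := hR.bound x
  have h2 := real_inner_le_norm x (R x)
  have h3 : inner ℝ x (yosida l R x) = l * (l * inner ℝ x (R x) - ‖x‖ ^ 2) := by
    simp [yosida, inner_smul_right, inner_sub_right]
  rw [h3]
  refine mul_nonpos_of_nonneg_of_nonpos hl.le ?_
  nlinarith [norm_nonneg x, norm_nonneg (R x), mul_le_mul_of_nonneg_left h2 hl.le,
    mul_le_mul_of_nonneg_left h1 (norm_nonneg x)]

theorem commute_yosida {k : ℝ} {R Q : H →L[ℝ] H} (h : Commute R Q) :
    Commute R (yosida k Q) :=
  ((h.smul_right k).sub_right (Commute.one_right R)).smul_right k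

theorem yosida_commute_yosida {l k : ℝ} {R Q : H →L[ℝ] H} (h : Commute R Q) :
    Commute (yosida l R) (yosida k Q) :=
  ((((commute_yosida h).smul_left l).sub_left (Commute.one_left _)).smul_left l)

theorem exp_smul_commute_apply (B : H →L[ℝ] H) (x : H) (t : ℝ) :
    NormedSpace.exp (t • B) (B x) = B (NormedSpace.exp (t • B) x) := by
  have h : Commute B (NormedSpace.exp (t • B)) := (Commute.refl B).smul_right t |>.exp_right
  exact (congrArg (fun T : H →L[ℝ] H => T x) h.eq).symm

variable [CompleteSpace H]

theorem hasDerivAt_exp_smul_apply (B : H →L[ℝ] H) (x : H) (t : ℝ) :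
    HasDerivAt (fun s : ℝ => NormedSpace.exp (s • B) x) (NormedSpace.exp (t • B) (B x)) t := by
  have h := hasDerivAt_exp_smul_const B t
  have := h.clm_apply (hasDerivAt_const t x)
  simpa using this

/-- `B` commutes with its exponential, so the velocity of the orbit is `B` applied to the orbit, and
the norm cannot grow. -/
theorem norm_exp_smul_apply_le {B : H →L[ℝ] H} (hB : ∀ x, inner ℝ x (B x) ≤ 0) (x : H) {t : ℝ}
    (ht : 0 ≤ t) : ‖NormedSpace.exp (t • B) x‖ ≤ ‖x‖ := by
  have h := norm_sq_antitoneOn (f := fun s : ℝ => NormedSpace.exp (s • B) x)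
    (f' := fun s => NormedSpace.exp (s • B) (B x))
    (fun s _ => (hasDerivAt_exp_smul_apply B x s).hasDerivWithinAt)
    (fun s _ => by rw [exp_smul_commute_apply]; exact hB _)
    (self_mem_Ici) ht ht
  simp only [zero_smul, NormedSpace.exp_zero, one_apply_eq_self] at h
  exact (pow_le_pow_iff_left₀ (norm_nonneg _) (norm_nonneg _) two_ne_zero).mp h

/-- Two commuting dissipative bounded operators generate semigroups that differ by at most
`t ‖B x - C x‖`. -/
theorem norm_exp_sub_exp_le {B C : H →L[ℝ] H} (hB : ∀ x, inner ℝ x (B x) ≤ 0)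
    (hC : ∀ x, inner ℝ x (C x) ≤ 0) (hBC : Commute B C) (x : H) {t : ℝ} (ht : 0 ≤ t) :
    ‖NormedSpace.exp (t • B) x - NormedSpace.exp (t • C) x‖ ≤ t * ‖B x - C x‖ := by
  -- This path runs from `exp (t C) x` to `exp (t B) x`. By commutation its velocity is `B x - C x`
  -- acted on by two contractions.
  let g : ℝ → H := fun s => NormedSpace.exp ((t - s) • C) (NormedSpace.exp (s • B) x)
  have hg : ∀ s, HasDerivAt g
      (NormedSpace.exp ((t - s) • C) (NormedSpace.exp (s • B) (B x - C x))) s := by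
    intro s
    have h1 : HasDerivAt (fun s : ℝ => NormedSpace.exp ((t - s) • C))
        (-(NormedSpace.exp ((t - s) • C) * C)) s := by
      have := (hasDerivAt_exp_smul_const C (t - s)).scomp s ((hasDerivAt_id s).const_sub t)
      simpa [Function.comp_def] using this
    have h2 := h1.clm_apply (hasDerivAt_exp_smul_apply B x s)
    have h3 : C (NormedSpace.exp (s • B) x) = NormedSpace.exp (s • B) (C x) := by
      have h : Commute C (NormedSpace.exp (s • B)) := (hBC.symm.smul_right s).exp_right
      exact congrArg (fun T : H →L[ℝ] H => T x) h.eq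
    convert h2 using 1
    simp [h3, sub_eq_add_neg, add_comm]
  have := norm_image_sub_le_of_norm_deriv_le_segment' (f := g) (a := 0) (b := t)
    (C := ‖B x - C x‖) (fun s _ => (hg s).hasDerivWithinAt) (fun s hs =>
      (norm_exp_smul_apply_le hC _ (by linarith [hs.2])).trans
        (norm_exp_smul_apply_le hB _ hs.1)) t (right_mem_Icc.mpr ht)
  simpa [g, NormedSpace.exp_zero, mul_comm] using this

/-- On the domain, `l R x - x = R (A x)` is `O(1/l)`; the general case follows by density because
the operators `l R` are contractions. -/
theorem tendsto_smul_resolvent (hA : IsMaxDissipative A) {R : ℕ → H →L[ℝ] H}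
    (hR : ∀ n : ℕ, IsResolvent A (n + 1) (R n)) (y : H) :
    Tendsto (fun n : ℕ => ((n : ℝ) + 1) • R n y) atTop (𝓝 y) := by
  rw [Metric.tendsto_atTop]
  intro ε hε
  obtain ⟨x, hxy, x', hx⟩ := Metric.dense_iff.mp hA.dense_dom y (ε / 3) (by positivity)
  obtain ⟨N, hN⟩ := exists_nat_gt (‖x'‖ / (ε / 3))
  refine ⟨N, fun n hn => ?_⟩
  have hn1 : (0 : ℝ) < n + 1 := by positivity
  have h1 : ((n : ℝ) + 1) • R n x - x = R n x' := by
    have h1 := (hR n).left_inv x x' hx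
    rw [map_sub, map_smul] at h1
    rw [sub_eq_iff_eq_add, ← sub_eq_iff_eq_add', h1]
  have h2 : ‖R n x'‖ < ε / 3 := by
    have hb := (hR n).bound x'
    have hn' : (N : ℝ) ≤ n := by exact_mod_cast hn
    rw [div_lt_iff₀ (by positivity)] at hN
    by_contra hc
    push Not at hc
    nlinarith
  have h3 : ‖((n : ℝ) + 1) • R n (y - x)‖ ≤ ‖y - x‖ := by
    rw [norm_smul, Real.norm_of_nonneg hn1.le]
    exact (hR n).bound _
  have h4 : ‖y - x‖ < ε / 3 := by
    rwa [Metric.mem_ball, dist_comm, dist_eq_norm] at hxy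
  have h5 : ((n : ℝ) + 1) • R n y - y
      = ((n : ℝ) + 1) • R n (y - x) + R n x' - (y - x) := by
    rw [← h1, map_sub, smul_sub]; abel
  rw [dist_eq_norm, h5]
  calc _ ≤ ‖((n : ℝ) + 1) • R n (y - x)‖ + ‖R n x'‖ + ‖y - x‖ :=
        (norm_sub_le _ _).trans (add_le_add_left (norm_add_le _ _) _)
    _ < ε := by linarith

/-- For `z` in the domain the Yosida approximations applied to `z` converge, and
`norm_exp_sub_exp_le` passes this on to the exponentials; contractivity extends it to all `x`.
Replacing `t` by `max t 0` makes the orbits constant for negative times, so that continuity at `0`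
needs no one-sided argument. -/
theorem uniformCauchySeqOn_exp_yosida (hA : IsMaxDissipative A) {R : ℕ → H →L[ℝ] H}
    (hR : ∀ n : ℕ, IsResolvent A (n + 1) (R n)) (x : H) (T : ℝ) :
    UniformCauchySeqOn
      (fun (n : ℕ) (t : ℝ) => NormedSpace.exp (max t 0 • yosida (n + 1) (R n)) x)
      atTop (Iic T) := by
  have hY : ∀ (n : ℕ) (x : H), inner ℝ x (yosida (n + 1) (R n) x) ≤ 0 := fun n =>
    inner_yosida_nonpos (by positivity) (hR n)
  rw [Metric.uniformCauchySeqOn_iff]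
  intro ε hε
  obtain ⟨z, hzx, z', hz⟩ := Metric.dense_iff.mp hA.dense_dom x (ε / 3) (by positivity)
  have hzx' : ‖x - z‖ < ε / 3 := by
    rwa [Metric.mem_ball, dist_comm, dist_eq_norm] at hzx
  have hc : CauchySeq fun n : ℕ => yosida (n + 1) (R n) z := by
    have : (fun n : ℕ => yosida (n + 1) (R n) z) = fun n : ℕ => ((n : ℝ) + 1) • R n z' := by
      ext n
      exact yosida_apply_of_mem (hR n) hz
    rw [this]
    exact (tendsto_smul_resolvent hA hR z').cauchySeq
  obtain ⟨N, hN⟩ := Metric.cauchySeq_iff.mp hc (ε / (3 * (max T 0 + 1))) (by positivity)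
  refine ⟨N, fun m hm n hn t ht => ?_⟩
  have ht0 : 0 ≤ max t 0 := le_max_right _ _
  have htT : max t 0 ≤ max T 0 := max_le_max_right 0 ht
  have h1 := norm_exp_sub_exp_le (hY m) (hY n)
    (yosida_commute_yosida ((hR m).commute (hR n))) z ht0
  have h2 := hN m hm n hn
  rw [dist_eq_norm, lt_div_iff₀ (by positivity)] at h2
  have h3 := norm_exp_smul_apply_le (hY m) (x - z) ht0
  have h4 := norm_exp_smul_apply_le (hY n) (x - z) ht0
  have h5 : max t 0 * ‖yosida (m + 1) (R m) z - yosida (n + 1) (R n) z‖ ≤ ε / 3 := by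
    nlinarith [norm_nonneg (yosida (m + 1) (R m) z - yosida (n + 1) (R n) z)]
  rw [dist_eq_norm]
  have h6 : NormedSpace.exp (max t 0 • yosida (m + 1) (R m)) x
      - NormedSpace.exp (max t 0 • yosida (n + 1) (R n)) x
      = NormedSpace.exp (max t 0 • yosida (m + 1) (R m)) (x - z)
      - NormedSpace.exp (max t 0 • yosida (n + 1) (R n)) (x - z)
      + (NormedSpace.exp (max t 0 • yosida (m + 1) (R m)) z
      - NormedSpace.exp (max t 0 • yosida (n + 1) (R n)) z) := by
    rw [map_sub, map_sub]; abel
  rw [h6]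
  refine (norm_add_le _ _).trans_lt ?_
  have h7 := norm_sub_le (NormedSpace.exp (max t 0 • yosida (m + 1) (R m)) (x - z))
    (NormedSpace.exp (max t 0 • yosida (n + 1) (R n)) (x - z))
  linarith

/-- A maximal dissipative operator in a Hilbert space generates a semigroup; the orbits that start
in the domain are strong solutions. -/
theorem IsMaxDissipative.exists_semigroup (hA : IsMaxDissipative A) :
    ∃ S : ℝ → H → H, (∀ x, S 0 x = x) ∧ (∀ x, Continuous fun t => S t x) ∧
      ∀ x y, (x, y) ∈ A → ∀ t, 0 ≤ t → (S t x, S t y) ∈ A ∧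
        HasDerivWithinAt (fun s => S s x) (S t y) (Ici 0) t := by
  choose R hR using fun n : ℕ =>
    hA.exists_resolvent (l := (n : ℝ) + 1) (by positivity)
  have hcau := uniformCauchySeqOn_exp_yosida hA hR
  have hY : ∀ (n : ℕ) (x : H), inner ℝ x (yosida (n + 1) (R n) x) ≤ 0 := fun n =>
    inner_yosida_nonpos (by positivity) (hR n)
  have hlim : ∀ (t : ℝ) (x : H), ∃ y, Tendsto
      (fun n : ℕ => NormedSpace.exp (max t 0 • yosida (n + 1) (R n)) x) atTop (𝓝 y) :=
    fun t x => cauchySeq_tendsto_of_complete ((hcau x t).cauchySeq (self_mem_Iic))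
  choose S hS using hlim
  have hcont : ∀ x, Continuous fun t => S t x := by
    intro x
    rw [continuous_iff_continuousAt]
    intro t
    -- The end point `t + 1` makes the region of uniform convergence a neighbourhood of `t`.
    have hu := (hcau x (t + 1)).tendstoUniformlyOn_of_tendsto (fun s _ => hS s x)
    refine (hu.continuousOn (Frequently.of_forall fun n => ?_)).continuousAt
      (Iic_mem_nhds (by linarith))
    refine Continuous.continuousOn ?_
    have h1 : Continuous fun s : ℝ => NormedSpace.exp (s • yosida (n + 1) (R n)) x :=
      continuous_iff_continuousAt.mpr fun s => (hasDerivAt_exp_smul_apply _ x s).continuousAt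
    exact h1.comp (continuous_id.max continuous_const)
  have hS0 : ∀ x, S 0 x = x := fun x =>
    tendsto_nhds_unique (hS 0 x) (by simp [NormedSpace.exp_zero])
  refine ⟨S, hS0, hcont, fun x y hxy t ht => ⟨?_, ?_⟩⟩
  -- `R 0` is the resolvent at `1`, so `x = R 0 (x - y)`. As `S t` commutes with `R 0`, `S t x = R 0
  -- (S t x - S t y)`, which places the pair in the graph.
  · have hcomm : ∀ z, S t (R 0 z) = R 0 (S t z) := fun z => by
      refine tendsto_nhds_unique (hS t (R 0 z)) ?_
      refine (((R 0).continuous.tendsto _).comp (hS t z)).congr fun n => ?_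
      have h : Commute (R 0) (NormedSpace.exp (max t 0 • yosida (n + 1) (R n))) :=
        ((commute_yosida ((hR 0).commute (hR n))).smul_right _).exp_right
      exact congrArg (fun T : H →L[ℝ] H => T z) h.eq
    have hsub : S t (x - y) = S t x - S t y :=
      tendsto_nhds_unique (hS t (x - y)) (((hS t x).sub (hS t y)).congr fun n => by
        rw [map_sub])
    have h1 := (hR 0).left_inv x y hxy
    simp only [Nat.cast_zero, zero_add, one_smul] at h1
    have h2 := (hR 0).mem (S t (x - y))
    rw [← hcomm, h1, hsub] at h2
    simpa using h2
  -- The integrated equation survives the limit of the approximations, and the continuity of `s ↦ S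
  -- s y` then allows it to be differentiated.
  · have hint : ∀ t, 0 ≤ t → S t x = x + ∫ s in (0 : ℝ)..t, S s y := by
      intro t ht
      have hd : Tendsto (fun n : ℕ => ∫ s in (0 : ℝ)..t,
          NormedSpace.exp (max s 0 • yosida (n + 1) (R n)) (yosida (n + 1) (R n) x)) atTop
          (𝓝 (∫ s in (0 : ℝ)..t, S s y)) := by
        refine intervalIntegral.tendsto_integral_filter_of_dominated_convergence
          (fun _ => ‖y‖) ?_ ?_ ?_ ?_
        · refine Eventually.of_forall fun n => ?_
          have h1 : Continuous fun s : ℝ =>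
              NormedSpace.exp (s • yosida (n + 1) (R n)) (yosida (n + 1) (R n) x) :=
            continuous_iff_continuousAt.mpr fun s =>
              (hasDerivAt_exp_smul_apply _ _ s).continuousAt
          exact (h1.comp (continuous_id.max continuous_const)).aestronglyMeasurable
        · refine Eventually.of_forall fun n => Eventually.of_forall fun s _ => ?_
          refine (norm_exp_smul_apply_le (hY n) _ (le_max_right _ _)).trans ?_
          rw [yosida_apply_of_mem (hR n) hxy, norm_smul, Real.norm_of_nonneg (by positivity)]
          exact (hR n).bound y
        · exact intervalIntegrable_const
        · refine Eventually.of_forall fun s _ => ?_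
          -- In the integrand `y` may replace the Yosida approximation of `A x`: their difference
          -- tends to `0` and the exponentials are contractions.
          have h1 : Tendsto (fun n : ℕ => NormedSpace.exp (max s 0 • yosida (n + 1) (R n))
              (yosida (n + 1) (R n) x - y)) atTop (𝓝 0) := by
            refine squeeze_zero_norm
              (fun n => norm_exp_smul_apply_le (hY n) _ (le_max_right _ _)) ?_
            have h2 := (tendsto_smul_resolvent hA hR y).sub_const y
            rw [sub_self] at h2
            refine h2.norm.congr' (Eventually.of_forall fun n => ?_) |>.trans (by simp)
            rw [yosida_apply_of_mem (hR n) hxy]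
          have h2 := h1.add (hS s y)
          rw [zero_add] at h2
          refine h2.congr fun n => ?_
          rw [map_sub, sub_add_cancel]
      have hl := hS t x
      rw [max_eq_left ht] at hl
      refine tendsto_nhds_unique hl ((hd.const_add x).congr fun n => ?_)
      have h1 : ∫ s in (0 : ℝ)..t,
          NormedSpace.exp (max s 0 • yosida (n + 1) (R n)) (yosida (n + 1) (R n) x)
          = ∫ s in (0 : ℝ)..t,
          NormedSpace.exp (s • yosida (n + 1) (R n)) (yosida (n + 1) (R n) x) := by
        refine intervalIntegral.integral_congr fun s hs => ?_
        rw [uIcc_of_le ht] at hs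
        simp only [max_eq_left hs.1]
      have h2 : Continuous fun s : ℝ =>
          NormedSpace.exp (s • yosida (n + 1) (R n)) (yosida (n + 1) (R n) x) :=
        continuous_iff_continuousAt.mpr fun s => (hasDerivAt_exp_smul_apply _ _ s).continuousAt
      rw [h1, intervalIntegral.integral_eq_sub_of_hasDerivAt
        (fun s _ => hasDerivAt_exp_smul_apply _ x s) (h2.intervalIntegrable _ _)]
      simp [NormedSpace.exp_zero]
    have h1 := (((hcont y).integral_hasStrictDerivAt 0 t).hasDerivAt.const_add x).hasDerivWithinAt
      (s := Ici 0)
    exact h1.congr (fun s hs => hint s hs) (hint t ht)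

end Semigroup

/-! ### Transfer to an equivalent norm, uniqueness, and the abstract decay rate -/

section Embedding

variable {X K : Type*} [NormedAddCommGroup X] [NormedSpace ℝ X]
  [NormedAddCommGroup K] [InnerProductSpace ℝ K]

/-- Generation of a semigroup in a Banach space whose norm is equivalent to the Hilbert norm
`‖Φ x‖`. -/
theorem exists_semigroup_of_embedding [CompleteSpace X] [CompleteSpace K] (Φ : X →L[ℝ] K) {c : ℝ}
    (hΦ : ∀ x, ‖x‖ ≤ c * ‖Φ x‖) (A : Submodule ℝ (X × X))
    (dissip : ∀ x y, (x, y) ∈ A → inner ℝ (Φ x) (Φ y) ≤ 0)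
    (single : ∀ y, (0, y) ∈ A → y = 0)
    (surj : ∀ l : ℝ, 0 < l → ∀ f : X, ∃ x y, (x, y) ∈ A ∧ l • x - y = f) :
    ∃ S : ℝ → X → X, (∀ x, S 0 x = x) ∧ (∀ x, Continuous fun t => S t x) ∧
      ∀ x y, (x, y) ∈ A → ∀ t, 0 ≤ t → (S t x, S t y) ∈ A ∧
        HasDerivWithinAt (fun s => S s x) (S t y) (Ici 0) t := by
  have hanti : AntilipschitzWith c.toNNReal Φ := by
    refine ContinuousLinearMap.antilipschitz_of_bound Φ fun x => (hΦ x).trans ?_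
    exact mul_le_mul_of_nonneg_right (Real.le_coe_toNNReal c) (norm_nonneg _)
  -- Being bounded below, `Φ` identifies `X` with a closed subspace of `K`, which is a Hilbert
  -- space; the graph is transported there.
  have hcl : IsClosed (range Φ) := hanti.isClosed_range Φ.uniformContinuous
  let e : X ≃L[ℝ] Φ.range := ContinuousLinearMap.equivRange hanti.injective hcl
  have he : ∀ x, ((e x : Φ.range) : K) = Φ x := fun x => rfl
  have hcl' : IsClosed (Φ.range : Set K) := hcl
  have hcomp : CompleteSpace Φ.range := hcl'.completeSpace_coe
  let A' : Submodule ℝ (Φ.range × Φ.range) :=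
    A.map ((e : X →ₗ[ℝ] Φ.range).prodMap (e : X →ₗ[ℝ] Φ.range))
  have hmem : ∀ x y, (x, y) ∈ A → (e x, e y) ∈ A' := fun x y h => ⟨(x, y), h, rfl⟩
  have hA : IsMaxDissipative A' := by
    refine ⟨?_, ?_, ?_⟩
    · rintro _ ⟨⟨x, y⟩, h, rfl⟩
      exact dissip x y h
    · rintro y' ⟨⟨x, y⟩, h, h'⟩
      have h1 : e x = 0 := congrArg Prod.fst h'
      have h2 : e y = y' := congrArg Prod.snd h'
      rw [map_eq_zero_iff e e.injective] at h1
      subst h1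
      rw [← h2, single y h, map_zero]
    · intro l hl f
      obtain ⟨x, y, h, hf⟩ := surj l hl (e.symm f)
      refine ⟨(e x, e y), hmem x y h, ?_⟩
      simp only
      rw [← map_smul, ← map_sub, hf, e.apply_symm_apply]
  obtain ⟨S, h0, hc, hS⟩ := hA.exists_semigroup
  refine ⟨fun t x => e.symm (S t (e x)), fun x => by simp [h0],
    fun x => e.symm.continuous.comp (hc (e x)), fun x y h t ht => ?_⟩
  obtain ⟨h1, h2⟩ := hS _ _ (hmem x y h) t ht
  constructor
  · obtain ⟨⟨x', y'⟩, h3, h4⟩ := h1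
    have h5 : e x' = S t (e x) := congrArg Prod.fst h4
    have h6 : e y' = S t (e y) := congrArg Prod.snd h4
    simp only
    rw [← h5, ← h6, e.symm_apply_apply, e.symm_apply_apply]
    exact h3
  · exact (e.symm : Φ.range →L[ℝ] X).hasFDerivAt.comp_hasDerivWithinAt t h2

/-- Uniqueness of strong solutions of a dissipative equation. -/
theorem eqOn_of_dissipative (Φ : X →L[ℝ] K) (hΦ : Function.Injective Φ)
    (A : Submodule ℝ (X × X)) (dissip : ∀ x y, (x, y) ∈ A → inner ℝ (Φ x) (Φ y) ≤ 0)
    {f g f' g' : ℝ → X}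
    (hf : ∀ t, 0 ≤ t → (f t, f' t) ∈ A ∧ HasDerivWithinAt f (f' t) (Ici 0) t)
    (hg : ∀ t, 0 ≤ t → (g t, g' t) ∈ A ∧ HasDerivWithinAt g (g' t) (Ici 0) t)
    (h0 : f 0 = g 0) : EqOn f g (Ici 0) := by
  intro t ht
  have h := norm_sq_antitoneOn (f := fun t => Φ (f t - g t)) (f' := fun t => Φ (f' t - g' t))
    (fun s hs => Φ.hasFDerivAt.comp_hasDerivWithinAt s ((hf s hs).2.sub (hg s hs).2))
    (fun s hs => dissip _ _ (A.sub_mem (hf s hs).1 (hg s hs).1)) self_mem_Ici ht ht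
  simp only [h0, sub_self, map_zero, norm_zero] at h
  have h1 : ‖Φ (f t - g t)‖ = 0 :=
    pow_eq_zero_iff two_ne_zero |>.mp (le_antisymm (by simpa using h) (by positivity))
  exact sub_eq_zero.mp ((map_eq_zero_iff Φ hΦ).mp (norm_eq_zero.mp h1))

/-- If the dissipation of an orbit and of its time derivative together control its energy, then
the energy is `O(1/t)`. -/
theorem mul_norm_sq_le_of_dissipation (Φ : X →L[ℝ] K) {C : ℝ} {x y z : ℝ → X}
    (hx : ∀ t, 0 ≤ t → HasDerivWithinAt x (y t) (Ici 0) t)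
    (hy : ∀ t, 0 ≤ t → HasDerivWithinAt y (z t) (Ici 0) t)
    (hxy : ∀ t, 0 ≤ t → inner ℝ (Φ (x t)) (Φ (y t)) ≤ 0)
    (hC : ∀ t, 0 ≤ t → ‖Φ (x t)‖ ^ 2
      ≤ C * (-(2 * inner ℝ (Φ (x t)) (Φ (y t))) - 2 * inner ℝ (Φ (y t)) (Φ (z t))))
    (hC0 : 0 ≤ C) {t : ℝ} (ht : 0 ≤ t) :
    t * ‖Φ (x t)‖ ^ 2 ≤ C * (‖Φ (x 0)‖ ^ 2 + ‖Φ (y 0)‖ ^ 2) := by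
  have hx' : ∀ s, 0 ≤ s → HasDerivWithinAt (fun s => ‖Φ (x s)‖ ^ 2)
      (2 * inner ℝ (Φ (x s)) (Φ (y s))) (Ici 0) s := fun s hs =>
    (Φ.hasFDerivAt.comp_hasDerivWithinAt s (hx s hs)).norm_sq
  have hy' : ∀ s, 0 ≤ s → HasDerivWithinAt (fun s => ‖Φ (y s)‖ ^ 2)
      (2 * inner ℝ (Φ (y s)) (Φ (z s))) (Ici 0) s := fun s hs =>
    (Φ.hasFDerivAt.comp_hasDerivWithinAt s (hy s hs)).norm_sq
  -- The Lyapunov function is `s ‖Φ x‖² + C (‖Φ x‖² + ‖Φ y‖²)`. The term `‖Φ x‖²` produced by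
  -- differentiating the factor `s` is absorbed by the `C`-weighted dissipation through `hC`.
  have hG : ∀ s, 0 ≤ s → HasDerivWithinAt
      (fun s => s * ‖Φ (x s)‖ ^ 2 + C * (‖Φ (x s)‖ ^ 2 + ‖Φ (y s)‖ ^ 2))
      (1 * ‖Φ (x s)‖ ^ 2 + s * (2 * inner ℝ (Φ (x s)) (Φ (y s)))
        + C * (2 * inner ℝ (Φ (x s)) (Φ (y s)) + 2 * inner ℝ (Φ (y s)) (Φ (z s))))
      (Ici 0) s := fun s hs =>
    ((hasDerivWithinAt_id s _).mul (hx' s hs)).add (((hx' s hs).add (hy' s hs)).const_mul C)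
  have hanti : AntitoneOn
      (fun s => s * ‖Φ (x s)‖ ^ 2 + C * (‖Φ (x s)‖ ^ 2 + ‖Φ (y s)‖ ^ 2)) (Ici 0) := by
    refine antitoneOn_of_hasDerivWithinAt_nonpos (convex_Ici 0)
      (fun s hs => (hG s hs).continuousWithinAt)
      (fun s hs => (hG s (interior_subset hs)).mono interior_subset) fun s hs => ?_
    have hs0 : 0 ≤ s := interior_subset hs
    have h1 := hC s hs0
    have h2 := mul_nonneg hs0 (neg_nonneg.mpr (hxy s hs0))
    linarith
  have h := hanti self_mem_Ici (show t ∈ Ici (0 : ℝ) from ht) ht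
  simp only [zero_mul, zero_add] at h
  have : 0 ≤ C * (‖Φ (x t)‖ ^ 2 + ‖Φ (y t)‖ ^ 2) := by positivity
  linarith

end Embedding

/-! ### Primitives of integrable functions and integration by parts -/

section Primitive

variable {𝕜 : Type*} [RCLike 𝕜] {L : ℝ}

/-- The primitive on `(0, L)` that vanishes at `0`. -/
def prim (L : ℝ) (b : ℝ → 𝕜) (x : ℝ) : 𝕜 := ∫ y in (0 : ℝ)..x, b y ∂(volume.restrict (Ioo 0 L))

theorem continuous_prim {b : ℝ → 𝕜} (hb : Integrable b (volume.restrict (Ioo 0 L))) :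
    Continuous (prim L b) := hb.continuous_primitive 0

@[simp] theorem prim_zero (b : ℝ → 𝕜) : prim L b 0 = 0 := intervalIntegral.integral_same

theorem prim_congr {a b : ℝ → 𝕜} (h : a =ᵐ[volume.restrict (Ioo 0 L)] b) (x : ℝ) :
    prim L a x = prim L b x :=
  intervalIntegral.integral_congr_ae (h.mono fun _ hy _ => hy)

theorem ae_mem_Ioo : ∀ᵐ x ∂(volume.restrict (Ioo 0 L)), x ∈ Ioo 0 L :=
  ae_restrict_mem measurableSet_Ioo

theorem prim_eq_setIntegral_Iic (b : ℝ → 𝕜) {x : ℝ} (hx : 0 ≤ x) :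
    prim L b x = ∫ y in Iic x, b y ∂(volume.restrict (Ioo 0 L)) := by
  rw [prim, intervalIntegral.integral_of_le hx]
  refine setIntegral_congr_set ?_
  filter_upwards [ae_mem_Ioo (L := L)] with y hy
  refine propext ?_
  exact ⟨fun h => h.2, fun h => ⟨hy.1, h⟩⟩

theorem prim_end (hL : 0 < L) (b : ℝ → 𝕜) :
    prim L b L = ∫ y in Ioo 0 L, b y := by
  rw [prim_eq_setIntegral_Iic b hL.le, Measure.restrict_restrict measurableSet_Iic]
  congr 2
  ext y
  simp only [mem_inter_iff, mem_Iic, mem_Ioo]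
  exact ⟨fun h => h.2, fun h => ⟨h.2.le, h⟩⟩

theorem norm_prim_le {b : ℝ → 𝕜} (hb : Integrable b (volume.restrict (Ioo 0 L))) {x : ℝ}
    (hx : 0 ≤ x) : ‖prim L b x‖ ≤ ∫ y in Ioo 0 L, ‖b y‖ := by
  rw [prim_eq_setIntegral_Iic b hx]
  exact (norm_integral_le_integral_norm _).trans
    (setIntegral_le_integral hb.norm (Eventually.of_forall fun _ => norm_nonneg _))

/-- Integration by parts for primitives. -/
theorem integral_mul_prim_add {a b : ℝ → 𝕜} (ha : Integrable a (volume.restrict (Ioo 0 L)))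
    (hb : Integrable b (volume.restrict (Ioo 0 L))) :
    (∫ x in Ioo 0 L, a x * prim L b x) + ∫ x in Ioo 0 L, prim L a x * b x
      = (∫ x in Ioo 0 L, a x) * ∫ x in Ioo 0 L, b x := by
  set μ := volume.restrict (Ioo 0 L) with hμ
  -- By Fubini the two terms are the integrals of `a(x) b(y)` over `y ≤ x` and over `x < y`.
  let s : Set (ℝ × ℝ) := {z | z.2 ≤ z.1}
  have hs : MeasurableSet s := measurableSet_le measurable_snd measurable_fst
  let f : ℝ × ℝ → 𝕜 := fun z => a z.1 * b z.2
  have hf : Integrable f (μ.prod μ) := ha.mul_prod hb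
  have h1 : ∫ x, a x * prim L b x ∂μ = ∫ z in s, f z ∂(μ.prod μ) := by
    rw [← integral_indicator hs, integral_prod _ (hf.indicator hs)]
    refine integral_congr_ae ?_
    filter_upwards [ae_mem_Ioo (L := L)] with x hx
    rw [prim_eq_setIntegral_Iic b hx.1.le, ← integral_indicator measurableSet_Iic,
      ← integral_const_mul]
    refine integral_congr_ae (Eventually.of_forall fun y => ?_)
    by_cases h : y ≤ x <;> simp [indicator, s, f, h]
  have h2 : ∫ x, prim L a x * b x ∂μ = ∫ z in sᶜ, f z ∂(μ.prod μ) := by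
    rw [← integral_indicator hs.compl, integral_prod_symm _ (hf.indicator hs.compl)]
    refine integral_congr_ae ?_
    filter_upwards [ae_mem_Ioo (L := L)] with y hy
    have : prim L a y = ∫ x in Iio y, a x ∂μ := by
      rw [prim_eq_setIntegral_Iic a hy.1.le]
      exact setIntegral_congr_set Iio_ae_eq_Iic.symm
    rw [this, ← integral_indicator measurableSet_Iio, ← integral_mul_const]
    refine integral_congr_ae (Eventually.of_forall fun x => ?_)
    by_cases h : x < y
    · simp [indicator, s, f, h]
    · simp [indicator, s, f, h]
  rw [h1, h2, integral_add_compl hs hf, integral_prod_mul]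

theorem prim_conj (a : ℝ → 𝕜) (x : ℝ) :
    prim L (fun y => (starRingEnd 𝕜) (a y)) x = (starRingEnd 𝕜) (prim L a x) := by
  simp only [prim, intervalIntegral]
  rw [map_sub, integral_conj, integral_conj]

theorem integrable_mul_prim {a b : ℝ → 𝕜} (ha : Integrable a (volume.restrict (Ioo 0 L)))
    (hb : Integrable b (volume.restrict (Ioo 0 L))) :
    Integrable (fun x => a x * prim L b x) (volume.restrict (Ioo 0 L)) := by
  refine ha.mul_bdd (c := ∫ y in Ioo 0 L, ‖b y‖) (continuous_prim hb).aestronglyMeasurable ?_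
  filter_upwards [ae_mem_Ioo (L := L)] with x hx using norm_prim_le hb hx.1.le

theorem real_inner_eq_re_conj_mul (x y : 𝕜) :
    inner ℝ x y = RCLike.re ((starRingEnd 𝕜) x * y) := by
  rw [mul_comm]
  rfl

theorem integral_inner_prim_add {a b : ℝ → 𝕜} (ha : Integrable a (volume.restrict (Ioo 0 L)))
    (hb : Integrable b (volume.restrict (Ioo 0 L))) :
    (∫ x in Ioo 0 L, inner ℝ (a x) (prim L b x)) + ∫ x in Ioo 0 L, inner ℝ (prim L a x) (b x)
      = inner ℝ (∫ x in Ioo 0 L, a x) (∫ x in Ioo 0 L, b x) := by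
  have hca : Integrable (fun x => (starRingEnd 𝕜) (a x)) (volume.restrict (Ioo 0 L)) :=
    (RCLike.conjLIE (K := 𝕜)).toContinuousLinearEquiv.toContinuousLinearMap.integrable_comp ha
  have h := congrArg RCLike.re (integral_mul_prim_add hca hb)
  have i1 := integrable_mul_prim hca hb
  have i2 : Integrable (fun x => prim L (fun y => (starRingEnd 𝕜) (a y)) x * b x)
      (volume.restrict (Ioo 0 L)) := by
    simpa only [mul_comm] using integrable_mul_prim hb hca
  rw [map_add, ← integral_re i1, ← integral_re i2, integral_conj] at h
  simp only [prim_conj] at h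
  simp only [real_inner_eq_re_conj_mul]
  exact h

end Primitive

/-! ### Weak derivatives on an interval and the du Bois-Reymond lemma -/

section WeakDerivative

variable {𝕜 : Type*} [RCLike 𝕜] {L : ℝ}

theorem HasWeakDeriv.congr {f f' g g' : ℝ → 𝕜} (h : HasWeakDeriv L f g)
    (hf : f =ᵐ[volume.restrict (Ioo 0 L)] f') (hg : g =ᵐ[volume.restrict (Ioo 0 L)] g') :
    HasWeakDeriv L f' g' := by
  intro φ h1 h2 h3
  have e1 : ∫ x in Ioo 0 L, deriv φ x • f' x = ∫ x in Ioo 0 L, deriv φ x • f x :=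
    integral_congr_ae (hf.mono fun x hx => by simp only [hx])
  have e2 : ∫ x in Ioo 0 L, φ x • g' x = ∫ x in Ioo 0 L, φ x • g x :=
    integral_congr_ae (hg.mono fun x hx => by simp only [hx])
  rw [e1, e2, h φ h1 h2 h3]

theorem integrable_test {φ : ℝ → ℝ} (hφ : Continuous φ) :
    Integrable φ (volume.restrict (Ioo 0 L)) :=
  (hφ.integrableOn_Icc (a := 0) (b := L)).mono_set Ioo_subset_Icc_self

theorem integrable_ofReal_test {φ : ℝ → ℝ} (hφ : Continuous φ) :
    Integrable (fun x => (φ x : 𝕜)) (volume.restrict (Ioo 0 L)) :=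
  (integrable_test hφ).ofReal

theorem integrable_smul_of_continuous {f : ℝ → 𝕜} (hf : Integrable f (volume.restrict (Ioo 0 L)))
    {φ : ℝ → ℝ} (hφ : Continuous φ) :
    Integrable (fun x => φ x • f x) (volume.restrict (Ioo 0 L)) := by
  obtain ⟨K, hK⟩ := isCompact_Icc.exists_bound_of_continuousOn (hφ.continuousOn (s := Icc 0 L))
  refine hf.bdd_smul K hφ.aestronglyMeasurable ?_
  filter_upwards [ae_mem_Ioo (L := L)] with x hx using hK x (Ioo_subset_Icc_self hx)

theorem prim_deriv {φ : ℝ → ℝ} (hφ : ContDiff ℝ ∞ φ) (hs : tsupport φ ⊆ Ioo 0 L) {x : ℝ}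
    (hx : x ∈ Icc 0 L) : prim L (fun y => ((deriv φ y : ℝ) : 𝕜)) x = φ x := by
  have h0 : φ 0 = 0 := image_eq_zero_of_notMem_tsupport fun h => lt_irrefl _ (hs h).1
  have hd : Continuous (deriv φ) := hφ.continuous_deriv (by simp)
  rw [prim, intervalIntegral.integral_of_le hx.1, Measure.restrict_restrict measurableSet_Ioc,
    integral_ofReal]
  have : ((Ioc 0 x ∩ Ioo 0 L : Set ℝ)) =ᵐ[volume] Ioc 0 x := by
    rcases hx.2.lt_or_eq with h | h
    · have hsub : Ioc 0 x ⊆ Ioo 0 L := fun y hy => ⟨hy.1, hy.2.trans_lt h⟩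
      exact (inter_eq_left.mpr hsub).eventuallyEq
    · rw [h, inter_eq_right.mpr Ioo_subset_Ioc_self]
      exact Ioo_ae_eq_Ioc
  rw [setIntegral_congr_set this, ← intervalIntegral.integral_of_le hx.1,
    intervalIntegral.integral_deriv_eq_sub (fun y _ => (hφ.differentiable (by simp)) y)
      (hd.intervalIntegrable _ _), h0, sub_zero]

theorem integral_deriv_test (hL : 0 < L) {φ : ℝ → ℝ} (hφ : ContDiff ℝ ∞ φ)
    (hs : tsupport φ ⊆ Ioo 0 L) : ∫ y in Ioo 0 L, ((deriv φ y : ℝ) : 𝕜) = 0 := by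
  rw [← prim_end hL, prim_deriv hφ hs (right_mem_Icc.mpr hL.le),
    image_eq_zero_of_notMem_tsupport fun h => lt_irrefl _ (hs h).2, RCLike.ofReal_zero]

/-- A test function is the primitive of its own derivative, which has mean zero, so integration by
parts for primitives has no boundary term. -/
theorem hasWeakDeriv_prim (hL : 0 < L) {g : ℝ → 𝕜} (hg : Integrable g (volume.restrict (Ioo 0 L)))
    (c : 𝕜) : HasWeakDeriv L (fun x => c + prim L g x) g := by
  intro φ hφ hc hs
  have hd : Continuous (deriv φ) := hφ.continuous_deriv (by simp)
  have h := integral_mul_prim_add (integrable_ofReal_test (𝕜 := 𝕜) (L := L) hd) hg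
  rw [integral_deriv_test hL hφ hs, zero_mul] at h
  have e1 : ∫ x in Ioo 0 L, deriv φ x • (c + prim L g x)
      = ∫ x in Ioo 0 L, ((deriv φ x : ℝ) : 𝕜) * prim L g x := by
    simp only [RCLike.real_smul_eq_coe_mul, mul_add]
    rw [integral_add ((integrable_ofReal_test hd).mul_const c)
      (integrable_mul_prim (integrable_ofReal_test hd) hg), integral_mul_const,
      integral_deriv_test hL hφ hs, zero_mul, zero_add]
  have e2 : ∫ x in Ioo 0 L, φ x • g x
      = ∫ x in Ioo 0 L, prim L (fun y => ((deriv φ y : ℝ) : 𝕜)) x * g x := by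
    refine integral_congr_ae ?_
    filter_upwards [ae_mem_Ioo (L := L)] with x hx
    rw [prim_deriv hφ hs (Ioo_subset_Icc_self hx), RCLike.real_smul_eq_coe_mul]
  rw [e1, e2]
  exact eq_neg_of_add_eq_zero_left h

/-- A test function with zero mean is the derivative of a test function. -/
theorem exists_test_primitive {h : ℝ → ℝ} (hh : ContDiff ℝ ∞ h) (hc : HasCompactSupport h)
    (hs : tsupport h ⊆ Ioo 0 L) (h0 : ∫ x in Ioo 0 L, h x = 0) :
    ∃ χ : ℝ → ℝ, ContDiff ℝ ∞ χ ∧ HasCompactSupport χ ∧ tsupport χ ⊆ Ioo 0 L ∧ deriv χ = h := by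
  rcases (tsupport h).eq_empty_or_nonempty with hemp | hne
  · have hz : h = 0 := by rwa [tsupport_eq_empty_iff] at hemp
    refine ⟨0, contDiff_const, HasCompactSupport.zero, by simp [tsupport_zero], ?_⟩
    rw [hz]
    exact deriv_const' 0
  obtain ⟨a, ha, hal⟩ := hc.isCompact.exists_isLeast hne
  obtain ⟨b, hb, hbg⟩ := hc.isCompact.exists_isGreatest hne
  have hab : a ≤ b := hal hb
  have hzero : ∀ x, x ∉ Icc a b → h x = 0 := fun x hx =>
    image_eq_zero_of_notMem_tsupport fun hx' => hx ⟨hal hx', hbg hx'⟩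
  let χ : ℝ → ℝ := fun x => ∫ y in (0 : ℝ)..x, h y
  have hder : ∀ x, HasDerivAt χ (h x) x := fun x =>
    (hh.continuous.integral_hasStrictDerivAt 0 x).hasDerivAt
  have hdχ : deriv χ = h := funext fun x => (hder x).deriv
  have ha0 : 0 < a := (hs ha).1
  have hint : ∫ y in (0 : ℝ)..b, h y = 0 := by
    rw [intervalIntegral.integral_of_le (ha0.le.trans hab)]
    refine Eq.trans (setIntegral_eq_of_subset_of_forall_sdiff_eq_zero measurableSet_Ioo ?_ ?_).symm h0
    · exact fun y hy => ⟨hy.1, hy.2.trans_lt (hs hb).2⟩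
    · exact fun y hy => hzero y fun h => hy.2 ⟨hy.1.1, h.2⟩
  -- To the left of `a` nothing has been integrated yet; to the right of `b` the primitive equals
  -- the total mean, which is zero.
  have hsupp : Function.support χ ⊆ Icc a b := by
    intro x hx
    by_contra hx'
    apply hx
    rcases lt_or_ge x a with hxa | hxa
    · refine intervalIntegral.integral_zero_ae (Eventually.of_forall fun y hy => hzero y ?_)
      exact fun h => absurd h.1 (not_le.mpr (hy.2.trans_lt (max_lt ha0 hxa)))
    · have hbx : b < x := by
        by_contra hbx
        exact hx' ⟨hxa, not_lt.mp hbx⟩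
      have hi : ∀ u v, IntervalIntegrable h volume u v := fun u v =>
        hh.continuous.intervalIntegrable u v
      have h1 : ∫ y in b..x, h y = 0 :=
        intervalIntegral.integral_zero_ae (Eventually.of_forall fun y hy => by
          rw [uIoc_of_le hbx.le] at hy
          exact hzero y fun h => absurd h.2 (not_le.mpr hy.1))
      show ∫ y in (0 : ℝ)..x, h y = 0
      rw [← intervalIntegral.integral_add_adjacent_intervals (hi 0 b) (hi b x), hint, h1, add_zero]
  have htsupp : tsupport χ ⊆ Icc a b := closure_minimal hsupp isClosed_Icc
  refine ⟨χ, ?_, HasCompactSupport.of_support_subset_isCompact isCompact_Icc hsupp,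
    htsupp.trans fun y hy => ⟨(hs ha).1.trans_le hy.1, hy.2.trans_lt (hs hb).2⟩, hdχ⟩
  rw [contDiff_infty_iff_deriv, hdχ]
  exact ⟨fun x => (hder x).differentiableAt, hh⟩

/-- A function with vanishing weak derivative is constant. -/
theorem HasWeakDeriv.ae_eq_const (hL : 0 < L) {f : ℝ → 𝕜}
    (hf : Integrable f (volume.restrict (Ioo 0 L))) (h : HasWeakDeriv L f (fun _ => 0)) :
    ∃ c, f =ᵐ[volume.restrict (Ioo 0 L)] fun _ => c := by
  -- The radii keep the bump inside `(0, L)`. Its normalization `ψ` has integral one, and the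
  -- constant is the `ψ`-weighted mean of `f`.
  let B : ContDiffBump (L / 2) := ⟨L / 8, L / 4, by positivity, by linarith⟩
  let ψ : ℝ → ℝ := B.normed volume
  have hψ : ContDiff ℝ ∞ ψ := B.contDiff_normed
  have hψc : HasCompactSupport ψ := B.hasCompactSupport_normed
  have hψs : tsupport ψ ⊆ Ioo 0 L := by
    rw [B.tsupport_normed_eq, Real.closedBall_eq_Icc]
    exact fun y hy => ⟨by simp only [B, mem_Icc] at hy; linarith [hy.1],
      by simp only [B, mem_Icc] at hy; linarith [hy.2]⟩
  have hsub : ∀ g : ℝ → ℝ, tsupport g ⊆ Ioo 0 L → ∀ F : ℝ → 𝕜,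
      ∫ x, g x • F x = ∫ x in Ioo 0 L, g x • F x := by
    intro g hg F
    refine (setIntegral_eq_integral_of_forall_compl_eq_zero fun x hx => ?_).symm
    rw [image_eq_zero_of_notMem_tsupport fun h => hx (hg h), zero_smul]
  have hψ1 : ∫ x in Ioo 0 L, ψ x = 1 := by
    rw [← B.integral_normed (μ := volume)]
    refine setIntegral_eq_integral_of_forall_compl_eq_zero fun x hx => ?_
    exact image_eq_zero_of_notMem_tsupport fun h => hx (hψs h)
  let c : 𝕜 := ∫ x in Ioo 0 L, ψ x • f x
  refine ⟨c, ?_⟩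
  have hfc : Integrable (fun x => f x - c) (volume.restrict (Ioo 0 L)) :=
    hf.sub (integrable_const c)
  have key : ∀ᵐ x ∂volume, x ∈ Ioo 0 L → f x - c = 0 := by
    refine isOpen_Ioo.ae_eq_zero_of_integral_contDiff_smul_eq_zero
      (IntegrableOn.locallyIntegrableOn hfc) fun φ hφ hφc hφs => ?_
    rw [hsub φ hφs]
    let k : ℝ := ∫ x in Ioo 0 L, φ x
    have iφ := integrable_test (L := L) hφ.continuous
    have iψ := integrable_test (L := L) hψ.continuous
    have hts : tsupport (fun x => φ x - k * ψ x) ⊆ tsupport φ ∪ tsupport ψ := by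
      refine closure_minimal (fun x hx => ?_)
        ((isClosed_tsupport φ).union (isClosed_tsupport ψ))
      by_contra hn
      rw [mem_union, not_or] at hn
      exact hx (by simp [image_eq_zero_of_notMem_tsupport hn.1,
        image_eq_zero_of_notMem_tsupport hn.2])
    -- Subtracting `k ψ` removes the mean of `φ`, so the difference is the derivative of an
    -- admissible test function.
    obtain ⟨χ, h1, h2, h3, h4⟩ := exists_test_primitive (L := L) (h := fun x => φ x - k * ψ x)
      (hφ.sub (contDiff_const.mul hψ))
      ((hφc.isCompact.union hψc.isCompact).of_isClosed_subset (isClosed_tsupport _) hts)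
      (hts.trans (union_subset hφs hψs))
      (by rw [integral_sub iφ (iψ.const_mul k), integral_const_mul, hψ1, mul_one, sub_self])
    have h5 := h χ h1 h2 h3
    rw [h4] at h5
    simp only [smul_zero, integral_zero, neg_zero, sub_smul, mul_smul] at h5
    have i1 := integrable_smul_of_continuous hf hφ.continuous
    have i2 := integrable_smul_of_continuous hf hψ.continuous
    have i3 : Integrable (fun x => k • ψ x • f x) (volume.restrict (Ioo 0 L)) := i2.smul k
    rw [integral_sub i1 i3, integral_smul] at h5
    simp only [smul_sub]
    rw [integral_sub i1 (iφ.smul_const c), integral_smul_const]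
    exact h5
  rw [EventuallyEq, ae_restrict_iff' measurableSet_Ioo]
  exact key.mono fun x hx hx' => sub_eq_zero.mp (hx hx')

theorem HasWeakDeriv.exists_eq_prim (hL : 0 < L) {f g : ℝ → 𝕜}
    (hf : Integrable f (volume.restrict (Ioo 0 L))) (hg : Integrable g (volume.restrict (Ioo 0 L)))
    (h : HasWeakDeriv L f g) :
    ∃ c, f =ᵐ[volume.restrict (Ioo 0 L)] fun x => c + prim L g x := by
  have ip : Integrable (prim L g) (volume.restrict (Ioo 0 L)) :=
    ((continuous_prim hg).integrableOn_Icc (a := 0) (b := L)).mono_set Ioo_subset_Icc_self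
  have hd : HasWeakDeriv L (fun x => f x - prim L g x) (fun _ => (0 : 𝕜)) := by
    intro φ h1 h2 h3
    have hd : Continuous (deriv φ) := h1.continuous_deriv (by simp)
    have h4 := h φ h1 h2 h3
    have h5 := hasWeakDeriv_prim hL hg 0 φ h1 h2 h3
    simp only [zero_add] at h5
    simp only [smul_sub, smul_zero, integral_zero, neg_zero]
    rw [integral_sub (integrable_smul_of_continuous hf hd) (integrable_smul_of_continuous ip hd),
      h4, h5, sub_self]
  obtain ⟨c, hc⟩ := hd.ae_eq_const hL (hf.sub ip)
  exact ⟨c, hc.mono fun x hx => sub_eq_iff_eq_add.mp hx⟩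

end WeakDerivative

/-! ### The mean, the Volterra operator, and `H¹₀` described by derivatives -/

section L2Operators

variable {𝕜 : Type*} [RCLike 𝕜] {L : ℝ}

theorem L2.integrable (f : L2 𝕜 L) : Integrable f (volume.restrict (Ioo 0 L)) :=
  (Lp.memLp f).integrable (by norm_num)

theorem L2.real_inner_eq (f g : L2 𝕜 L) :
    inner ℝ f g = ∫ x in Ioo 0 L, inner ℝ (f x) (g x) := L2.inner_def f g

theorem L2.norm_sq_eq (f : L2 𝕜 L) : ‖f‖ ^ 2 = ∫ x in Ioo 0 L, ‖f x‖ ^ 2 := by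
  rw [← real_inner_self_eq_norm_sq, L2.real_inner_eq]
  simp only [real_inner_self_eq_norm_sq]

theorem L2.exists_integral_norm_le :
    ∃ c : ℝ, 0 ≤ c ∧ ∀ f : L2 𝕜 L, ∫ x in Ioo 0 L, ‖f x‖ ≤ c * ‖f‖ := by
  set μ := volume.restrict (Ioo 0 L)
  refine ⟨(μ univ ^ (1 / (1 : ℝ≥0∞).toReal - 1 / (2 : ℝ≥0∞).toReal)).toReal,
    ENNReal.toReal_nonneg, fun f => ?_⟩
  have h := eLpNorm_le_eLpNorm_mul_rpow_measure_univ (p := 1) (q := 2) (by norm_num)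
    (Lp.aestronglyMeasurable f)
  have hfin : μ univ ^ (1 / (1 : ℝ≥0∞).toReal - 1 / (2 : ℝ≥0∞).toReal) ≠ (⊤ : ℝ≥0∞) :=
    ENNReal.rpow_ne_top_of_nonneg (by norm_num) (measure_ne_top μ _)
  rw [integral_norm_eq_lintegral_enorm (Lp.aestronglyMeasurable f), ← eLpNorm_one_eq_lintegral_enorm,
    Lp.norm_def, mul_comm, ← ENNReal.toReal_mul]
  exact ENNReal.toReal_mono (ENNReal.mul_ne_top (Lp.eLpNorm_ne_top f) hfin) h

/-- The integral over `(0, L)` as a functional on `L²(0, L)`. -/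
def mean (𝕜 : Type*) [RCLike 𝕜] (L : ℝ) : L2 𝕜 L →L[ℝ] 𝕜 :=
  LinearMap.mkContinuousOfExistsBound
    { toFun := fun f => ∫ x in Ioo 0 L, f x
      map_add' := fun f g => by
        rw [← integral_add (L2.integrable f) (L2.integrable g)]
        exact integral_congr_ae (Lp.coeFn_add f g)
      map_smul' := fun c f => by
        rw [RingHom.id_apply, ← integral_smul]
        exact integral_congr_ae (Lp.coeFn_smul c f) }
    (by
      obtain ⟨c, _, hc⟩ := L2.exists_integral_norm_le (𝕜 := 𝕜) (L := L)
      exact ⟨c, fun f => (norm_integral_le_integral_norm _).trans (hc f)⟩)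

theorem mean_apply (f : L2 𝕜 L) : mean 𝕜 L f = ∫ x in Ioo 0 L, f x := rfl

theorem memLp_prim (f : L2 𝕜 L) : MemLp (prim L f) 2 (volume.restrict (Ioo 0 L)) := by
  refine MemLp.of_bound (continuous_prim (L2.integrable f)).aestronglyMeasurable
    (∫ x in Ioo 0 L, ‖f x‖) ?_
  filter_upwards [ae_mem_Ioo (L := L)] with x hx using norm_prim_le (L2.integrable f) hx.1.le

/-- The primitive vanishing at `0` as a bounded operator on `L²(0, L)`. -/
def volterra (𝕜 : Type*) [RCLike 𝕜] (L : ℝ) : L2 𝕜 L →L[ℝ] L2 𝕜 L :=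
  LinearMap.mkContinuousOfExistsBound
    { toFun := fun f => (memLp_prim f).toLp
      map_add' := fun f g => by
        rw [← MemLp.toLp_add]
        refine MemLp.toLp_congr _ _ (Eventually.of_forall fun x => ?_)
        rw [Pi.add_apply, prim, prim, prim, ← intervalIntegral.integral_add
          (L2.integrable f).intervalIntegrable (L2.integrable g).intervalIntegrable]
        exact prim_congr (Lp.coeFn_add f g) x
      map_smul' := fun c f => by
        rw [RingHom.id_apply, ← MemLp.toLp_const_smul]
        refine MemLp.toLp_congr _ _ (Eventually.of_forall fun x => ?_)
        rw [Pi.smul_apply, prim, prim, ← intervalIntegral.integral_smul]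
        exact prim_congr (Lp.coeFn_smul c f) x }
    (by
      obtain ⟨c, hc0, hc⟩ := L2.exists_integral_norm_le (𝕜 := 𝕜) (L := L)
      refine ⟨(measureUnivNNReal (volume.restrict (Ioo 0 L)) : ℝ) ^ (2 : ℝ≥0∞).toReal⁻¹ * c,
        fun f => ?_⟩
      rw [mul_assoc]
      refine Lp.norm_le_of_ae_bound (by positivity) ?_
      filter_upwards [MemLp.coeFn_toLp (memLp_prim f), ae_mem_Ioo (L := L)] with x hx hx'
      refine (congrArg norm hx).le.trans ?_
      exact (norm_prim_le (L2.integrable f) hx'.1.le).trans (hc f))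

theorem volterra_coeFn (f : L2 𝕜 L) :
    volterra 𝕜 L f =ᵐ[volume.restrict (Ioo 0 L)] prim L f :=
  MemLp.coeFn_toLp (memLp_prim f)

/-- The Volterra operator is skew-adjoint up to a rank-one boundary term that vanishes on functions
of mean zero. This is what cancels the coupling terms in the Lax–Milgram form. -/
theorem inner_volterra_add (f g : L2 𝕜 L) :
    inner ℝ f (volterra 𝕜 L g) + inner ℝ (volterra 𝕜 L f) g
      = inner ℝ (mean 𝕜 L f) (mean 𝕜 L g) := by
  rw [mean_apply, mean_apply, ← integral_inner_prim_add (L2.integrable f) (L2.integrable g),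
    L2.real_inner_eq, L2.real_inner_eq]
  congr 1
  · exact integral_congr_ae ((volterra_coeFn g).mono fun x hx => by simp only [hx])
  · exact integral_congr_ae ((volterra_coeFn f).mono fun x hx => by simp only [hx])

/-- A function with weak derivative `g` is a constant plus the primitive of `g`; vanishing at `0`
kills the constant, and vanishing at `L` says that `g` has mean zero. Both conditions are closed in
`L² × L²`, and `H¹₀` becomes the space of mean-zero derivatives. -/
theorem mem_H10_iff (hL : 0 < L) (v : L2 𝕜 L × L2 𝕜 L) :
    v ∈ H10 𝕜 L ↔ v.1 = volterra 𝕜 L v.2 ∧ mean 𝕜 L v.2 = 0 := by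
  have hc := continuous_prim (L2.integrable v.2)
  constructor
  · rintro ⟨h, r, hr, hr0, hrL, hvr⟩
    obtain ⟨c, hc'⟩ := h.exists_eq_prim hL (L2.integrable v.1) (L2.integrable v.2)
    have hcc : Continuous fun x => c + prim L v.2 x := continuous_const.add hc
    have hae : r =ᵐ[volume.restrict (Icc 0 L)] fun x => c + prim L v.2 x := by
      rw [← restrict_Ioo_eq_restrict_Icc]
      filter_upwards [hvr, hc'] with x h1 h2
      rw [← h1, h2]
    -- Two continuous functions that agree almost everywhere agree up to the end points, so the
    -- boundary values can be read off.
    have heq := Measure.eqOn_Icc_of_ae_eq volume hL.ne hae hr hcc.continuousOn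
    have h0 := heq (left_mem_Icc.mpr hL.le)
    have h1 := heq (right_mem_Icc.mpr hL.le)
    simp only [hr0, prim_zero, add_zero] at h0
    simp only [hrL, ← h0, zero_add, prim_end hL] at h1
    refine ⟨Lp.ext ?_, h1.symm⟩
    filter_upwards [hc', volterra_coeFn v.2] with x h2 h3
    rw [h2, h3, ← h0, zero_add]
  · rintro ⟨h1, h2⟩
    have hae : v.1 =ᵐ[volume.restrict (Ioo 0 L)] prim L v.2 := by
      rw [h1]
      exact volterra_coeFn v.2
    refine ⟨(hasWeakDeriv_prim hL (L2.integrable v.2) 0).congr ?_ EventuallyEq.rfl,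
      prim L v.2, hc.continuousOn, prim_zero _, ?_, hae⟩
    · filter_upwards [hae] with x hx
      rw [hx, zero_add]
    · rw [prim_end hL]
      exact h2

theorem fn_eq_volterra (hL : 0 < L) (u : H10 𝕜 L) : fn u = volterra 𝕜 L (dx u) :=
  ((mem_H10_iff hL u.1).mp u.2).1

theorem mean_dx (hL : 0 < L) (u : H10 𝕜 L) : mean 𝕜 L (dx u) = 0 :=
  ((mem_H10_iff hL u.1).mp u.2).2

/-- The element of `H¹₀(0, L)` with a given weak derivative of zero mean. -/
def ofDeriv (hL : 0 < L) (v : L2 𝕜 L) (hv : mean 𝕜 L v = 0) : H10 𝕜 L :=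
  ⟨(volterra 𝕜 L v, v), (mem_H10_iff hL _).mpr ⟨rfl, hv⟩⟩

@[simp] theorem dx_ofDeriv (hL : 0 < L) (v : L2 𝕜 L) (hv : mean 𝕜 L v = 0) :
    dx (ofDeriv hL v hv) = v := rfl

@[simp] theorem fn_ofDeriv (hL : 0 < L) (v : L2 𝕜 L) (hv : mean 𝕜 L v = 0) :
    fn (ofDeriv hL v hv) = volterra 𝕜 L v := rfl

theorem H10.ext_dx (hL : 0 < L) {u v : H10 𝕜 L} (h : dx u = dx v) : u = v := by
  refine Subtype.ext (Prod.ext ?_ h)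
  have h1 := fn_eq_volterra hL u
  rw [h, ← fn_eq_volterra hL v] at h1
  exact h1

theorem completeSpace_H10 (hL : 0 < L) : CompleteSpace (H10 𝕜 L) := by
  have : IsClosed (H10 𝕜 L : Set (L2 𝕜 L × L2 𝕜 L)) := by
    have : (H10 𝕜 L : Set (L2 𝕜 L × L2 𝕜 L))
        = {v | v.1 = volterra 𝕜 L v.2} ∩ {v | mean 𝕜 L v.2 = 0} := by
      ext v
      exact mem_H10_iff hL v
    rw [this]
    exact (isClosed_eq continuous_fst ((volterra 𝕜 L).continuous.comp continuous_snd)).inter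
      (isClosed_eq ((mean 𝕜 L).continuous.comp continuous_snd) continuous_const)
  exact this.completeSpace_coe

theorem memLp_smul_const {φ : ℝ → ℝ} (hφ : Continuous φ) (c : 𝕜) :
    MemLp (fun x => φ x • c) 2 (volume.restrict (Ioo 0 L)) := by
  obtain ⟨K, hK⟩ := isCompact_Icc.exists_bound_of_continuousOn (hφ.continuousOn (s := Icc 0 L))
  refine MemLp.of_bound (hφ.smul continuous_const).aestronglyMeasurable (K * ‖c‖) ?_
  filter_upwards [ae_mem_Ioo (L := L)] with x hx
  rw [norm_smul]
  exact mul_le_mul_of_nonneg_right (hK x (Ioo_subset_Icc_self hx)) (norm_nonneg _)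

/-- The weak derivative is minus the adjoint of the derivative on `H¹₀`. -/
theorem hasWeakDeriv_iff_inner (hL : 0 < L) (f g : L2 𝕜 L) :
    HasWeakDeriv L f g ↔ ∀ u : H10 𝕜 L, inner ℝ (dx u) f = - inner ℝ (fn u) g := by
  constructor
  · intro h u
    obtain ⟨c, hc⟩ := h.exists_eq_prim hL (L2.integrable f) (L2.integrable g)
    have h1 := inner_volterra_add (dx u) g
    rw [mean_dx hL, inner_zero_left, ← fn_eq_volterra hL] at h1
    -- The constant by which `f` differs from the primitive of `g` is invisible to the mean-zero
    -- function `dx u`.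
    have h2 : inner ℝ (dx u) f = inner ℝ (dx u) (volterra 𝕜 L g) := by
      rw [← sub_eq_zero, ← inner_sub_right, L2.real_inner_eq]
      have e : ∫ x in Ioo 0 L, inner ℝ (dx u x) ((f - volterra 𝕜 L g : L2 𝕜 L) x)
          = ∫ x in Ioo 0 L, inner ℝ c (dx u x) := by
        refine integral_congr_ae ?_
        filter_upwards [hc, volterra_coeFn g, Lp.coeFn_sub f (volterra 𝕜 L g)] with x h1 h2 h3
        rw [h3, Pi.sub_apply, h1, h2, add_sub_cancel_right, real_inner_comm]
      rw [e, integral_inner (L2.integrable (dx u)), ← mean_apply, mean_dx hL, inner_zero_right]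
    rw [h2]
    linarith
  · intro h φ hφ hc hs
    have hd : Continuous (deriv φ) := hφ.continuous_deriv (by simp)
    have i1 := integrable_smul_of_continuous (L2.integrable f) hd
    have i2 := integrable_smul_of_continuous (L2.integrable g) hφ.continuous
    rw [eq_neg_iff_add_eq_zero]
    -- The `𝕜`-valued identity is recovered from real inner products by testing with the element `φ
    -- c` of `H¹₀` for every `c` in `𝕜`.
    refine ext_inner_left ℝ fun c => ?_
    rw [inner_zero_right, inner_add_right, ← integral_inner i1, ← integral_inner i2]
    let v : L2 𝕜 L := (memLp_smul_const (L := L) hd c).toLp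
    have hv : v =ᵐ[volume.restrict (Ioo 0 L)] fun x => deriv φ x • c :=
      MemLp.coeFn_toLp (memLp_smul_const (L := L) hd c)
    have hprim : ∀ x ∈ Icc 0 L, prim L v x = φ x • c := by
      intro x hx
      rw [prim_congr hv, RCLike.real_smul_eq_coe_mul, ← prim_deriv hφ hs hx, prim, prim,
        ← intervalIntegral.integral_mul_const]
      simp only [RCLike.real_smul_eq_coe_mul]
    have hmean : mean 𝕜 L v = 0 := by
      rw [mean_apply, ← prim_end hL, hprim L (right_mem_Icc.mpr hL.le),
        image_eq_zero_of_notMem_tsupport fun h => lt_irrefl _ (hs h).2, zero_smul]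
    have h1 := h (ofDeriv hL v hmean)
    rw [dx_ofDeriv, fn_ofDeriv, L2.real_inner_eq, L2.real_inner_eq, eq_neg_iff_add_eq_zero] at h1
    refine Eq.trans ?_ h1
    congr 1
    · refine integral_congr_ae (hv.mono fun x hx => ?_)
      simp only [hx, inner_smul_left, inner_smul_right, RCLike.conj_to_real]
    · refine integral_congr_ae ?_
      filter_upwards [volterra_coeFn v, ae_mem_Ioo (L := L)] with x hx hx'
      rw [hx, hprim x (Ioo_subset_Icc_self hx')]
      simp only [inner_smul_left, inner_smul_right, RCLike.conj_to_real]

/-- `H¹₀` is dense in `L²`. -/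
theorem eq_zero_of_inner_fn_eq_zero (hL : 0 < L) {g : L2 𝕜 L}
    (h : ∀ u : H10 𝕜 L, inner ℝ (fn u) g = 0) : g = 0 := by
  -- The hypothesis says precisely that `g` is a weak derivative of zero.
  have hw : HasWeakDeriv L (0 : L2 𝕜 L) g :=
    (hasWeakDeriv_iff_inner hL 0 g).mpr fun u => by rw [h u, inner_zero_right, neg_zero]
  have key : ∀ᵐ x ∂volume, x ∈ Ioo 0 L → g x = 0 := by
    refine isOpen_Ioo.ae_eq_zero_of_integral_contDiff_smul_eq_zero
      (IntegrableOn.locallyIntegrableOn (L2.integrable g)) fun φ hφ hφc hφs => ?_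
    have h1 := hw φ hφ hφc hφs
    have h2 : ∫ x in Ioo 0 L, deriv φ x • (0 : L2 𝕜 L) x = 0 := by
      refine integral_eq_zero_of_ae ?_
      filter_upwards [Lp.coeFn_zero 𝕜 2 (volume.restrict (Ioo 0 L))] with x hx
      rw [hx]
      simp
    rw [h2, eq_comm, neg_eq_zero] at h1
    rw [← h1]
    refine (setIntegral_eq_integral_of_forall_compl_eq_zero fun x hx => ?_).symm
    rw [image_eq_zero_of_notMem_tsupport fun h => hx (hφs h), zero_smul]
  refine Lp.ext ?_
  have h3 : ∀ᵐ x ∂(volume.restrict (Ioo 0 L)), g x = 0 := by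
    rw [ae_restrict_iff' measurableSet_Ioo]
    exact key
  filter_upwards [h3, Lp.coeFn_zero 𝕜 2 (volume.restrict (Ioo 0 L))] with x h4 h5
  rw [h4, h5]
  rfl

end L2Operators

/-! ### Multiplication by continuous coefficients -/

section Multiplication

variable {𝕜 : Type*} [RCLike 𝕜] {L : ℝ}

theorem ae_norm_smul_le {a : ℝ → ℝ} {C : ℝ} (hC : ∀ x ∈ Icc 0 L, ‖a x‖ ≤ C) (f : ℝ → 𝕜) :
    ∀ᵐ x ∂(volume.restrict (Ioo 0 L)), ‖a x • f x‖ ≤ C * ‖f x‖ := by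
  filter_upwards [ae_mem_Ioo (L := L)] with x hx
  rw [norm_smul]
  exact mul_le_mul_of_nonneg_right (hC x (Ioo_subset_Icc_self hx)) (norm_nonneg _)

theorem aestronglyMeasurable_of_continuousOn {a : ℝ → ℝ} (ha : ContinuousOn a (Icc 0 L)) :
    AEStronglyMeasurable a (volume.restrict (Ioo 0 L)) :=
  (ha.mono Ioo_subset_Icc_self).aestronglyMeasurable measurableSet_Ioo

theorem memLp_smul {a : ℝ → ℝ} (ha : ContinuousOn a (Icc 0 L)) (f : L2 𝕜 L) :
    MemLp (fun x => a x • f x) 2 (volume.restrict (Ioo 0 L)) := by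
  obtain ⟨C, hC⟩ := isCompact_Icc.exists_bound_of_continuousOn ha
  exact (Lp.memLp f).of_le_mul
    ((aestronglyMeasurable_of_continuousOn ha).smul (Lp.aestronglyMeasurable f))
    (ae_norm_smul_le hC f)

/-- Multiplication by a function that is continuous on `[0, L]`, as an operator on `L²(0, L)`. -/
def mulOp (𝕜 : Type*) [RCLike 𝕜] {a : ℝ → ℝ} (ha : ContinuousOn a (Icc 0 L)) :
    L2 𝕜 L →L[ℝ] L2 𝕜 L :=
  LinearMap.mkContinuousOfExistsBound
    { toFun := fun f => (memLp_smul ha f).toLp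
      map_add' := fun f g => by
        rw [← MemLp.toLp_add]
        refine MemLp.toLp_congr _ _ ((Lp.coeFn_add f g).mono fun x hx => ?_)
        simp only [hx, Pi.add_apply, smul_add]
      map_smul' := fun c f => by
        rw [RingHom.id_apply, ← MemLp.toLp_const_smul]
        refine MemLp.toLp_congr _ _ ((Lp.coeFn_smul c f).mono fun x hx => ?_)
        simp only [hx, Pi.smul_apply]
        exact smul_comm _ _ _ }
    (by
      obtain ⟨C, hC⟩ := isCompact_Icc.exists_bound_of_continuousOn ha
      refine ⟨C, fun f => Lp.norm_le_mul_norm_of_ae_le_mul ?_⟩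
      filter_upwards [ae_norm_smul_le hC f, MemLp.coeFn_toLp (memLp_smul ha f)] with x h1 h2
      exact (congrArg norm h2).le.trans h1)

variable {a : ℝ → ℝ} (ha : ContinuousOn a (Icc 0 L))

theorem mulOp_coeFn (f : L2 𝕜 L) :
    mulOp 𝕜 ha f =ᵐ[volume.restrict (Ioo 0 L)] fun x => a x • f x :=
  MemLp.coeFn_toLp (memLp_smul ha f)

theorem inner_mulOp_left (f g : L2 𝕜 L) :
    inner ℝ (mulOp 𝕜 ha f) g = ∫ x in Ioo 0 L, a x * inner ℝ (f x) (g x) := by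
  rw [L2.real_inner_eq]
  refine integral_congr_ae ((mulOp_coeFn ha f).mono fun x hx => ?_)
  simp only [hx, inner_smul_left, RCLike.conj_to_real]

theorem inner_mulOp_comm (f g : L2 𝕜 L) :
    inner ℝ (mulOp 𝕜 ha f) g = inner ℝ f (mulOp 𝕜 ha g) := by
  rw [real_inner_comm (mulOp 𝕜 ha g) f, inner_mulOp_left, inner_mulOp_left]
  simp only [real_inner_comm]

theorem inner_mulOp_self (f : L2 𝕜 L) :
    inner ℝ (mulOp 𝕜 ha f) f = ∫ x in Ioo 0 L, a x * ‖f x‖ ^ 2 := by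
  rw [inner_mulOp_left]
  simp only [real_inner_self_eq_norm_sq]

theorem exists_le_inner_mulOp (hL : 0 < L) (hpos : ∀ x ∈ Icc 0 L, 0 < a x) :
    ∃ c : ℝ, 0 < c ∧ ∀ f : L2 𝕜 L, c * ‖f‖ ^ 2 ≤ inner ℝ (mulOp 𝕜 ha f) f := by
  obtain ⟨x₀, hx₀, hmin⟩ := isCompact_Icc.exists_isMinOn (nonempty_Icc.mpr hL.le) ha
  refine ⟨a x₀, hpos x₀ hx₀, fun f => ?_⟩
  have h2 : ∀ᵐ x ∂(volume.restrict (Ioo 0 L)),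
      inner ℝ (a x₀ • f x) (f x) ≤ inner ℝ (mulOp 𝕜 ha f x) (f x) := by
    filter_upwards [mulOp_coeFn ha f, ae_mem_Ioo (L := L)] with x hx hx'
    rw [hx, inner_smul_left, inner_smul_left, RCLike.conj_to_real, RCLike.conj_to_real,
      real_inner_self_eq_norm_sq]
    exact mul_le_mul_of_nonneg_right (hmin (Ioo_subset_Icc_self hx')) (by positivity)
  have h3 : a x₀ * ‖f‖ ^ 2 = ∫ x in Ioo 0 L, inner ℝ (a x₀ • f x) (f x) := by
    rw [L2.norm_sq_eq, ← integral_const_mul]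
    simp only [inner_smul_left, RCLike.conj_to_real, real_inner_self_eq_norm_sq]
  rw [h3, L2.real_inner_eq]
  refine integral_mono_ae ?_ (L2.integrable_inner _ _) h2
  have := (L2.integrable_inner (𝕜 := ℝ) f f).const_mul (a x₀)
  simpa only [inner_smul_left, RCLike.conj_to_real] using this

theorem inner_mulOp_sqrt (hpos : ∀ x ∈ Icc 0 L, 0 < a x) (f g : L2 𝕜 L) :
    inner ℝ (mulOp 𝕜 ha.sqrt f) (mulOp 𝕜 ha.sqrt g) = inner ℝ (mulOp 𝕜 ha f) g := by
  rw [inner_mulOp_left, inner_mulOp_left]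
  refine integral_congr_ae ?_
  filter_upwards [mulOp_coeFn ha.sqrt g, ae_mem_Ioo (L := L)] with x hx hx'
  rw [hx, inner_smul_right, ← mul_assoc, Real.mul_self_sqrt (hpos x (Ioo_subset_Icc_self hx')).le]

end Multiplication

/-! ### The operator in weak form, the energy norm and dissipativity -/

section Operator

variable {𝕜 : Type*} [RCLike 𝕜] {L : ℝ}

theorem ofReal_smul_L2 (r : ℝ) (g : L2 𝕜 L) : (r : 𝕜) • g = r • g :=
  (RCLike.real_smul_eq_coe_smul (K := 𝕜) r g).symm

/-- The weak derivative as a bounded operator from `H¹₀` to `L²`. -/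
def dxL (𝕜 : Type*) [RCLike 𝕜] (L : ℝ) : H10 𝕜 L →L[ℝ] L2 𝕜 L :=
  (ContinuousLinearMap.snd 𝕜 (L2 𝕜 L) (L2 𝕜 L) ∘L (H10 𝕜 L).subtypeL).restrictScalars ℝ

@[simp] theorem dx_add (u v : H10 𝕜 L) : dx (u + v) = dx u + dx v := rfl
@[simp] theorem fn_add (u v : H10 𝕜 L) : fn (u + v) = fn u + fn v := rfl
@[simp] theorem dx_smul (c : ℝ) (u : H10 𝕜 L) : dx (c • u) = c • dx u := rfl
@[simp] theorem fn_smul (c : ℝ) (u : H10 𝕜 L) : fn (c • u) = c • fn u := rfl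
@[simp] theorem dx_zero : dx (0 : H10 𝕜 L) = 0 := rfl
@[simp] theorem fn_zero : fn (0 : H10 𝕜 L) = 0 := rfl

theorem inner_dx_fn (hL : 0 < L) (u v : H10 𝕜 L) :
    inner ℝ (dx u) (fn v) = - inner ℝ (fn u) (dx v) :=
  (hasWeakDeriv_iff_inner hL (fn v) (dx v)).mp v.2.1 u

theorem dx_eq_zero_of_fn_eq_zero (hL : 0 < L) {u : H10 𝕜 L} (h : fn u = 0) : dx u = 0 :=
  eq_zero_of_inner_fn_eq_zero hL fun v => by
    have := inner_dx_fn hL v u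
    rw [h, inner_zero_right] at this
    linarith

theorem norm_fn_le (hL : 0 < L) (u : H10 𝕜 L) : ‖fn u‖ ≤ ‖volterra 𝕜 L‖ * ‖dx u‖ := by
  rw [fn_eq_volterra hL]
  exact (volterra 𝕜 L).le_opNorm _

variable {P : Params} (hP : P.Admissible)

/-- Multiplication by the coefficient `p`. -/
def mulP (𝕜 : Type*) [RCLike 𝕜] (hP : P.Admissible) : L2 𝕜 P.L →L[ℝ] L2 𝕜 P.L :=
  mulOp 𝕜 hP.p_reg.1

/-- Multiplication by the coefficient `m`. -/
def mulM (𝕜 : Type*) [RCLike 𝕜] (hP : P.Admissible) : L2 𝕜 P.L →L[ℝ] L2 𝕜 P.L :=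
  mulOp 𝕜 hP.m_reg.1

/-- Multiplication by the coefficient `δ`. -/
def mulD (𝕜 : Type*) [RCLike 𝕜] (hP : P.Admissible) : L2 𝕜 P.L →L[ℝ] L2 𝕜 P.L :=
  mulOp 𝕜 hP.δ_reg.1

theorem mulM_eq_iff (f g : L2 𝕜 P.L) :
    mulM 𝕜 hP f = g ↔
      ∀ᵐ x ∂(volume.restrict (Ioo 0 P.L)), f x = (P.m x : 𝕜)⁻¹ * g x := by
  have hne : ∀ x ∈ Ioo 0 P.L, (P.m x : 𝕜) ≠ 0 := fun x hx => by
    exact_mod_cast (hP.m_pos x (Ioo_subset_Icc_self hx)).ne'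
  constructor
  · rintro rfl
    filter_upwards [mulOp_coeFn hP.m_reg.1 f, ae_mem_Ioo (L := P.L)] with x h1 h2
    rw [mulM, h1, RCLike.real_smul_eq_coe_mul, inv_mul_cancel_left₀ (hne x h2)]
  · intro h
    refine Lp.ext ?_
    filter_upwards [mulOp_coeFn hP.m_reg.1 f, ae_mem_Ioo (L := P.L), h] with x h1 h2 h3
    rw [mulM, h1, RCLike.real_smul_eq_coe_mul, h3, mul_inv_cancel_left₀ (hne x h2)]

/-- The weak form of the operator. -/
theorem isImage_iff (u : H10 𝕜 P.L) (w θ q : L2 𝕜 P.L) (f₁ : H10 𝕜 P.L) (f₂ f₃ f₄ : L2 𝕜 P.L) :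
    IsImage P (u, w, θ, q) (f₁, f₂, f₃, f₄) ↔
      fn f₁ = w ∧ ∃ θ' : H10 𝕜 P.L, fn θ' = θ ∧
        (∀ φ : H10 𝕜 P.L, inner ℝ (dx φ) (mulP 𝕜 hP (dx u) + (2 : ℝ) • mulD 𝕜 hP (dx f₁))
          = - inner ℝ (fn φ) (mulM 𝕜 hP f₂ + P.η • dx θ')) ∧
        (∀ φ : H10 𝕜 P.L, P.κ * inner ℝ (dx φ) q = inner ℝ (fn φ) (f₃ + P.η • dx f₁)) ∧
        P.τ • f₄ = - (P.κ • dx θ' + P.β • q) := by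
  have hL := hP.L_pos
  have hκ := hP.κ_pos.ne'
  have hτ := hP.τ_pos.ne'
  have hσ : ∀ w' : H10 𝕜 P.L, (fun x => (P.p x : 𝕜) * dx u x + 2 * (P.δ x : 𝕜) * dx w' x)
      =ᵐ[volume.restrict (Ioo 0 P.L)]
      (mulP 𝕜 hP (dx u) + (2 : ℝ) • mulD 𝕜 hP (dx w') : L2 𝕜 P.L) := by
    intro w'
    filter_upwards [mulOp_coeFn hP.p_reg.1 (dx u), mulOp_coeFn hP.δ_reg.1 (dx w'),
      Lp.coeFn_add (mulP 𝕜 hP (dx u)) ((2 : ℝ) • mulD 𝕜 hP (dx w')),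
      Lp.coeFn_smul (2 : ℝ) (mulD 𝕜 hP (dx w'))] with x h1 h2 h3 h4
    rw [h3, Pi.add_apply, h4, Pi.smul_apply, mulP, mulD, h1, h2]
    simp only [RCLike.real_smul_eq_coe_mul, RCLike.ofReal_ofNat, mul_assoc]
  have hτi : ((P.τ : 𝕜))⁻¹ = ((P.τ⁻¹ : ℝ) : 𝕜) := by simp
  constructor
  · rintro ⟨w', θ', σx, qx, hw, hθ, h1, h2, rfl, h4, h5, h6⟩
    refine ⟨hw, θ', hθ, ?_, ?_, ?_⟩
    · have h7 : mulM 𝕜 hP f₂ = σx - P.η • dx θ' := by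
        rw [mulM_eq_iff]
        filter_upwards [h4, Lp.coeFn_sub σx (P.η • dx θ'), Lp.coeFn_smul P.η (dx θ')]
          with x h8 h9 h10
        rw [h8, h9, Pi.sub_apply, h10, Pi.smul_apply, RCLike.real_smul_eq_coe_mul]
      rw [h7, sub_add_cancel]
      exact (hasWeakDeriv_iff_inner hL _ _).mp (h1.congr (hσ f₁) EventuallyEq.rfl)
    · intro φ
      rw [h5, neg_smul, ofReal_smul_L2, ofReal_smul_L2, sub_add_cancel,
        (hasWeakDeriv_iff_inner hL _ _).mp h2 φ, inner_neg_right, inner_smul_right]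
      ring
    · rw [h6, ofReal_smul_L2, ofReal_smul_L2, hτi, neg_smul, ofReal_smul_L2, smul_neg,
        smul_inv_smul₀ hτ]
  · rintro ⟨hw, θ', hθ, h1, h2, h3⟩
    -- The derivatives of the stress and of `q` are read off from the second and third equations;
    -- the weak identities certify them.
    refine ⟨f₁, θ', mulM 𝕜 hP f₂ + P.η • dx θ', -(P.κ⁻¹ • (f₃ + P.η • dx f₁)), hw, hθ, ?_, ?_,
      rfl, ?_, ?_, ?_⟩
    · exact ((hasWeakDeriv_iff_inner hL _ _).mpr h1).congr (hσ f₁).symm EventuallyEq.rfl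
    · rw [hasWeakDeriv_iff_inner hL]
      intro φ
      rw [inner_neg_right, inner_smul_right, ← h2 φ, inv_mul_cancel_left₀ hκ, neg_neg]
    · have h7 := (mulM_eq_iff hP f₂ (mulM 𝕜 hP f₂)).mp rfl
      filter_upwards [h7, Lp.coeFn_add (mulM 𝕜 hP f₂) (P.η • dx θ'),
        Lp.coeFn_smul P.η (dx θ')] with x h8 h9 h10
      rw [h9, Pi.add_apply, h10, Pi.smul_apply, RCLike.real_smul_eq_coe_mul, add_sub_cancel_right,
        ← h8]
    · rw [neg_smul, ofReal_smul_L2, ofReal_smul_L2, smul_neg, neg_neg, smul_inv_smul₀ hκ,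
        add_sub_cancel_right]
    · rw [ofReal_smul_L2, ofReal_smul_L2, hτi, neg_smul, ofReal_smul_L2, ← smul_neg, ← h3,
        inv_smul_smul₀ hτ]

/-- The graph of the operator as a linear subspace. -/
def opGraph (𝕜 : Type*) [RCLike 𝕜] (hP : P.Admissible) :
    Submodule ℝ (Phase 𝕜 P.L × Phase 𝕜 P.L) where
  carrier := {z | IsImage P z.1 z.2}
  add_mem' := by
    rintro ⟨⟨u, w, θ, q⟩, ⟨f₁, f₂, f₃, f₄⟩⟩ ⟨⟨u', w', θ', q'⟩, ⟨g₁, g₂, g₃, g₄⟩⟩ h h'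
    simp only [mem_ofPred_eq, isImage_iff hP, Prod.mk_add_mk] at h h' ⊢
    obtain ⟨h1, t, h2, h3, h4, h5⟩ := h
    obtain ⟨k1, s, k2, k3, k4, k5⟩ := h'
    refine ⟨by simp [h1, k1], t + s, by simp [h2, k2], fun φ => ?_, fun φ => ?_, ?_⟩
    · have a := h3 φ
      have b := k3 φ
      simp only [dx_add, map_add, smul_add, inner_add_right] at a b ⊢
      linarith
    · have a := h4 φ
      have b := k4 φ
      simp only [dx_add, smul_add, inner_add_right] at a b ⊢
      linarith
    · simp only [dx_add, smul_add, h5, k5]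
      abel
  zero_mem' := by
    show IsImage P (0, 0, 0, 0) (0, 0, 0, 0)
    rw [isImage_iff hP]
    exact ⟨rfl, 0, rfl, by simp, by simp, by simp⟩
  smul_mem' := by
    rintro c ⟨⟨u, w, θ, q⟩, ⟨f₁, f₂, f₃, f₄⟩⟩ h
    simp only [mem_ofPred_eq, isImage_iff hP, Prod.smul_mk] at h ⊢
    obtain ⟨h1, t, h2, h3, h4, h5⟩ := h
    refine ⟨by simp [h1], c • t, by simp [h2], fun φ => ?_, fun φ => ?_, ?_⟩
    · have a := h3 φ
      simp only [dx_smul, map_smul, inner_smul_right, inner_add_right] at a ⊢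
      linear_combination c * a
    · have a := h4 φ
      simp only [dx_smul, inner_smul_right, inner_add_right] at a ⊢
      linear_combination c * a
    · simp only [dx_smul]
      rw [smul_comm P.τ, h5, smul_neg, smul_add, smul_comm P.κ, smul_comm P.β]

/-- The map from the phase space to a Hilbert space whose norm is the energy norm
(up to a factor `√2`). -/
def energyMap (𝕜 : Type*) [RCLike 𝕜] (hP : P.Admissible) :
    Phase 𝕜 P.L →L[ℝ] PiLp 2 (fun _ : Fin 4 => L2 𝕜 P.L) :=
  (PiLp.continuousLinearEquiv 2 ℝ (fun _ : Fin 4 => L2 𝕜 P.L)).symm.toContinuousLinearMap ∘L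
    ContinuousLinearMap.pi
      ![mulOp 𝕜 hP.p_reg.1.sqrt ∘L dxL 𝕜 P.L ∘L ContinuousLinearMap.fst ℝ _ _,
        mulOp 𝕜 hP.m_reg.1.sqrt ∘L ContinuousLinearMap.fst ℝ _ _ ∘L ContinuousLinearMap.snd ℝ _ _,
        ContinuousLinearMap.fst ℝ _ _ ∘L ContinuousLinearMap.snd ℝ _ _
          ∘L ContinuousLinearMap.snd ℝ _ _,
        √P.τ • (ContinuousLinearMap.snd ℝ _ _ ∘L ContinuousLinearMap.snd ℝ _ _
          ∘L ContinuousLinearMap.snd ℝ _ _)]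

theorem inner_energyMap (u u' : H10 𝕜 P.L) (w θ q w' θ' q' : L2 𝕜 P.L) :
    inner ℝ (energyMap 𝕜 hP (u, w, θ, q)) (energyMap 𝕜 hP (u', w', θ', q'))
      = inner ℝ (mulP 𝕜 hP (dx u)) (dx u') + inner ℝ (mulM 𝕜 hP w) w' + inner ℝ θ θ'
        + P.τ * inner ℝ q q' := by
  rw [mulP, mulM, ← inner_mulOp_sqrt hP.p_reg.1 hP.p_pos, ← inner_mulOp_sqrt hP.m_reg.1 hP.m_pos,
    PiLp.inner_apply, Fin.sum_univ_four]
  have : P.τ * inner ℝ q q' = inner ℝ (√P.τ • q) (√P.τ • q') := by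
    rw [inner_smul_left, inner_smul_right, RCLike.conj_to_real, ← mul_assoc,
      Real.mul_self_sqrt hP.τ_pos.le]
  rw [this]
  rfl

theorem stateEnergy_eq (V : Phase 𝕜 P.L) :
    stateEnergy P V = (1 / 2) * ‖energyMap 𝕜 hP V‖ ^ 2 := by
  obtain ⟨u, w, θ, q⟩ := V
  rw [← real_inner_self_eq_norm_sq, inner_energyMap, real_inner_self_eq_norm_sq,
    real_inner_self_eq_norm_sq, L2.norm_sq_eq, L2.norm_sq_eq, mulP, mulM, inner_mulOp_self,
    inner_mulOp_self]
  rfl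

/-- The coefficients are bounded below, and the Poincaré inequality `norm_fn_le` recovers `u` from
`u_x`. -/
theorem exists_norm_le_energyMap :
    ∃ c : ℝ, ∀ V : Phase 𝕜 P.L, ‖V‖ ≤ c * ‖energyMap 𝕜 hP V‖ := by
  obtain ⟨p₀, hp₀, hp⟩ := exists_le_inner_mulOp (𝕜 := 𝕜) hP.p_reg.1 hP.L_pos hP.p_pos
  obtain ⟨m₀, hm₀, hm⟩ := exists_le_inner_mulOp (𝕜 := 𝕜) hP.m_reg.1 hP.L_pos hP.m_pos
  obtain ⟨k, hk, hkp, hkm, hk1, hkτ⟩ : ∃ k : ℝ, 0 < k ∧ k ≤ p₀ ∧ k ≤ m₀ ∧ k ≤ 1 ∧ k ≤ P.τ :=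
    ⟨min (min p₀ m₀) (min 1 P.τ), by simp [hp₀, hm₀, hP.τ_pos], by simp, by simp, by simp, by simp⟩
  refine ⟨√k⁻¹ * (‖volterra 𝕜 P.L‖ + 1), ?_⟩
  rintro ⟨u, w, θ, q⟩
  set e := ‖energyMap 𝕜 hP (u, w, θ, q)‖ with he
  have hsum : k * (‖dx u‖ ^ 2 + ‖w‖ ^ 2 + ‖θ‖ ^ 2 + ‖q‖ ^ 2) ≤ e ^ 2 := by
    rw [he, ← real_inner_self_eq_norm_sq (energyMap 𝕜 hP _), inner_energyMap, real_inner_self_eq_norm_sq,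
      real_inner_self_eq_norm_sq]
    have h1 := hp (dx u)
    have h2 := hm w
    rw [mulP, mulM]
    nlinarith [mul_le_mul_of_nonneg_right hkp (sq_nonneg ‖dx u‖),
      mul_le_mul_of_nonneg_right hkm (sq_nonneg ‖w‖), mul_le_mul_of_nonneg_right hk1
      (sq_nonneg ‖θ‖), mul_le_mul_of_nonneg_right hkτ (sq_nonneg ‖q‖)]
  have key : ∀ r : ℝ, r ^ 2 ≤ ‖dx u‖ ^ 2 + ‖w‖ ^ 2 + ‖θ‖ ^ 2 + ‖q‖ ^ 2 → r ≤ √k⁻¹ * e := by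
    intro r hr
    refine le_of_sq_le_sq ?_ (by positivity)
    rw [mul_pow, Real.sq_sqrt (by positivity), inv_mul_eq_div, le_div_iff₀ hk]
    nlinarith
  have hv : 0 ≤ ‖volterra 𝕜 P.L‖ := ContinuousLinearMap.opNorm_nonneg _
  have hle : √k⁻¹ * e ≤ √k⁻¹ * (‖volterra 𝕜 P.L‖ + 1) * e := by
    have : 0 ≤ √k⁻¹ * e := by positivity
    nlinarith
  have hdx : ‖dx u‖ ≤ √k⁻¹ * e := key _ (by
    nlinarith [sq_nonneg ‖w‖, sq_nonneg ‖θ‖, sq_nonneg ‖q‖])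
  have hu : ‖u‖ ≤ √k⁻¹ * (‖volterra 𝕜 P.L‖ + 1) * e := by
    have h1 : ‖u‖ = max ‖fn u‖ ‖dx u‖ := rfl
    rw [h1]
    refine max_le ((norm_fn_le hP.L_pos u).trans ?_) (hdx.trans hle)
    have := mul_le_mul_of_nonneg_left hdx hv
    have h2 : 0 ≤ √k⁻¹ * e := by positivity
    nlinarith
  refine max_le hu (max_le ?_ (max_le ?_ ?_)) <;> refine (key _ ?_).trans hle <;>
    simp only <;>
    nlinarith [sq_nonneg ‖w‖, sq_nonneg ‖θ‖, sq_nonneg ‖q‖, sq_nonneg ‖dx u‖]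

/-- The energy identity. -/
theorem inner_energyMap_of_isImage {u f₁ : H10 𝕜 P.L} {w θ q f₂ f₃ f₄ : L2 𝕜 P.L}
    (h : IsImage P (u, w, θ, q) (f₁, f₂, f₃, f₄)) :
    inner ℝ (energyMap 𝕜 hP (u, w, θ, q)) (energyMap 𝕜 hP (f₁, f₂, f₃, f₄))
      = -(2 * inner ℝ (mulD 𝕜 hP (dx f₁)) (dx f₁)) - P.β * ‖q‖ ^ 2 := by
  rw [isImage_iff hP] at h
  obtain ⟨rfl, t, rfl, h3, h4, h5⟩ := h
  -- Momentum tested with the velocity, heat tested with the temperature, flux law paired with `q`.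
  -- The `η` terms cancel through `d`, the `κ` terms between `b` and `c`.
  have a := h3 f₁
  have b := h4 t
  have c := congrArg (inner ℝ q) h5
  have d := inner_dx_fn hP.L_pos t f₁
  rw [inner_energyMap]
  have e : inner ℝ (mulM 𝕜 hP (fn f₁)) f₂ = inner ℝ (fn f₁) (mulM 𝕜 hP f₂) :=
    inner_mulOp_comm _ _ _
  simp only [inner_add_right, inner_smul_right, inner_neg_right, real_inner_self_eq_norm_sq]
    at a b c d
  rw [e, real_inner_comm (dx f₁) (mulP 𝕜 hP (dx u)), real_inner_comm (dx f₁) (mulD 𝕜 hP (dx f₁))]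
  rw [real_inner_comm (fn f₁) (dx t)] at d
  rw [real_inner_comm q (dx t)] at b
  linear_combination a - b + c - P.η * d

theorem inner_mulD_nonneg (f : L2 𝕜 P.L) : 0 ≤ inner ℝ (mulD 𝕜 hP f) f := by
  obtain ⟨d₀, hd₀, hd⟩ := exists_le_inner_mulOp (𝕜 := 𝕜) hP.δ_reg.1 hP.L_pos hP.δ_pos
  exact le_trans (by positivity) (hd f)

theorem inner_energyMap_nonpos {U F : Phase 𝕜 P.L} (h : IsImage P U F) :
    inner ℝ (energyMap 𝕜 hP U) (energyMap 𝕜 hP F) ≤ 0 := by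
  obtain ⟨u, w, θ, q⟩ := U
  obtain ⟨f₁, f₂, f₃, f₄⟩ := F
  rw [inner_energyMap_of_isImage hP h]
  have h1 := inner_mulD_nonneg hP (dx f₁)
  have h2 := mul_nonneg hP.β_pos.le (sq_nonneg ‖q‖)
  linarith

/-- Elements of `H¹₀` with zero underlying function have zero derivative, so all derivative terms
drop out; density of `H¹₀` then forces `m f₂ = 0` and `f₃ = 0`. -/
theorem isImage_zero_left (hP : P.Admissible) {F : Phase 𝕜 P.L} (h : IsImage P 0 F) : F = 0 := by
  obtain ⟨f₁, f₂, f₃, f₄⟩ := F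
  have hL := hP.L_pos
  have h' : IsImage P ((0 : H10 𝕜 P.L), (0 : L2 𝕜 P.L), (0 : L2 𝕜 P.L), (0 : L2 𝕜 P.L))
    (f₁, f₂, f₃, f₄) := h
  rw [isImage_iff hP] at h'
  obtain ⟨h1, t, h2, h3, h4, h5⟩ := h'
  have hf1 := dx_eq_zero_of_fn_eq_zero hL h1
  have ht := dx_eq_zero_of_fn_eq_zero hL h2
  simp only [hf1, ht, dx_zero, map_zero, smul_zero, add_zero, inner_zero_right, mul_zero, neg_zero]
    at h3 h4 h5
  have e1 : f₁ = 0 := H10.ext_dx hL hf1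
  have e2 : f₂ = 0 := by
    have h6 := eq_zero_of_inner_fn_eq_zero hL fun φ => by
      have := h3 φ
      linarith
    obtain ⟨m₀, hm₀, hm⟩ := exists_le_inner_mulOp (𝕜 := 𝕜) hP.m_reg.1 hL hP.m_pos
    have h7 := hm f₂
    change _ ≤ inner ℝ (mulM 𝕜 hP f₂) f₂ at h7
    rw [h6, inner_zero_left] at h7
    have h8 : ‖f₂‖ ^ 2 ≤ 0 := by
      by_contra hc
      push Not at hc
      nlinarith
    exact norm_eq_zero.mp (pow_eq_zero_iff two_ne_zero |>.mp (le_antisymm h8 (by positivity)))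
  have e3 : f₃ = 0 := eq_zero_of_inner_fn_eq_zero hL fun φ => (h4 φ).symm
  have e4 : f₄ = 0 := (smul_eq_zero.mp h5).resolve_left hP.τ_pos.ne'
  rw [e1, e2, e3, e4]
  rfl

end Operator

/-! ### Surjectivity of `l - 𝒜` by Lax–Milgram -/

section Resolvent

variable {𝕜 : Type*} [RCLike 𝕜] {P : Params}

/-- The derivatives of the elements of `H¹₀`: the functions in `L²` with zero mean. -/
abbrev MeanZero (𝕜 : Type*) [RCLike 𝕜] (L : ℝ) : Submodule ℝ (L2 𝕜 L) :=
  LinearMap.ker (mean 𝕜 L : L2 𝕜 L →ₗ[ℝ] 𝕜)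

/-- The Lax–Milgram theorem in the form of solvability of `B z = ℓ`. -/
theorem exists_eq_of_isCoercive {V : Type*} [NormedAddCommGroup V] [InnerProductSpace ℝ V]
    [CompleteSpace V] {B : V →L[ℝ] V →L[ℝ] ℝ} (hB : IsCoercive B) (ℓ : V →L[ℝ] ℝ) :
    ∃ z, ∀ y, B z y = ℓ y := by
  refine ⟨hB.continuousLinearEquivOfBilin.symm ((InnerProductSpace.toDual ℝ V).symm ℓ),
    fun y => ?_⟩
  rw [← hB.continuousLinearEquivOfBilin_apply, ContinuousLinearEquiv.apply_symm_apply,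
    InnerProductSpace.toDual_symm_apply]

/-- This is the reduced system for velocity and temperature. The form is coercive because the
coupling terms in `η` cancel on the diagonal, while `δ` controls `w_x` and `r` controls `θ_x`. -/
theorem exists_weak_solution (hP : P.Admissible) {l r : ℝ} (hl : 0 < l) (hr : 0 < r)
    (h₁ h₂ h₃ h₄ : L2 𝕜 P.L) :
    ∃ w θ : H10 𝕜 P.L,
      (∀ φ : H10 𝕜 P.L, l⁻¹ * inner ℝ (mulP 𝕜 hP (dx w)) (dx φ)
        + 2 * inner ℝ (mulD 𝕜 hP (dx w)) (dx φ) + l * inner ℝ (mulM 𝕜 hP (fn w)) (fn φ)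
        + P.η * inner ℝ (dx θ) (fn φ) = inner ℝ h₁ (fn φ) + inner ℝ h₂ (dx φ)) ∧
      (∀ φ : H10 𝕜 P.L, l * inner ℝ (fn θ) (fn φ) + P.η * inner ℝ (dx w) (fn φ)
        + r * inner ℝ (dx θ) (dx φ) = inner ℝ h₃ (fn φ) + inner ℝ h₄ (dx φ)) := by
  have hL := hP.L_pos
  have hcl : IsClosed (MeanZero 𝕜 P.L : Set (L2 𝕜 P.L)) := (mean 𝕜 P.L).isClosed_ker
  have : CompleteSpace (MeanZero 𝕜 P.L) := hcl.completeSpace_coe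
  -- The unknowns are the derivatives `w_x` and `θ_x`, and `J` recovers the functions; the norm of
  -- `V` is then exactly what the form controls.
  let V := WithLp 2 (MeanZero 𝕜 P.L × MeanZero 𝕜 P.L)
  let W : V →L[ℝ] L2 𝕜 P.L := (MeanZero 𝕜 P.L).subtypeL ∘L WithLp.fstL 2 ℝ _ _
  let T : V →L[ℝ] L2 𝕜 P.L := (MeanZero 𝕜 P.L).subtypeL ∘L WithLp.sndL 2 ℝ _ _
  let J := volterra 𝕜 P.L
  let B : V →L[ℝ] V →L[ℝ] ℝ :=
    l⁻¹ • (innerSL ℝ).bilinearComp (mulP 𝕜 hP ∘L W) W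
      + (2 : ℝ) • (innerSL ℝ).bilinearComp (mulD 𝕜 hP ∘L W) W
      + l • (innerSL ℝ).bilinearComp (mulM 𝕜 hP ∘L J ∘L W) (J ∘L W)
      + P.η • (innerSL ℝ).bilinearComp T (J ∘L W)
      + (l • (innerSL ℝ).bilinearComp (J ∘L T) (J ∘L T)
      + P.η • (innerSL ℝ).bilinearComp W (J ∘L T)
      + r • (innerSL ℝ).bilinearComp T T)
  have hBa : ∀ z y : V, B z y = l⁻¹ * inner ℝ (mulP 𝕜 hP (W z)) (W y)
        + 2 * inner ℝ (mulD 𝕜 hP (W z)) (W y) + l * inner ℝ (mulM 𝕜 hP (J (W z))) (J (W y))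
        + P.η * inner ℝ (T z) (J (W y))
        + (l * inner ℝ (J (T z)) (J (T y)) + P.η * inner ℝ (W z) (J (T y))
        + r * inner ℝ (T z) (T y)) := fun z y => rfl
  have hW : ∀ z : V, mean 𝕜 P.L (W z) = 0 := fun z => z.fst.2
  have hT : ∀ z : V, mean 𝕜 P.L (T z) = 0 := fun z => z.snd.2
  have hcoer : IsCoercive B := by
    obtain ⟨d₀, hd₀, hd⟩ := exists_le_inner_mulOp (𝕜 := 𝕜) hP.δ_reg.1 hL hP.δ_pos
    obtain ⟨p₀, hp₀, hp⟩ := exists_le_inner_mulOp (𝕜 := 𝕜) hP.p_reg.1 hL hP.p_pos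
    obtain ⟨m₀, hm₀, hm⟩ := exists_le_inner_mulOp (𝕜 := 𝕜) hP.m_reg.1 hL hP.m_pos
    refine ⟨min (2 * d₀) r, lt_min (by positivity) hr, fun z => ?_⟩
    have hn : ‖z‖ * ‖z‖ = ‖W z‖ ^ 2 + ‖T z‖ ^ 2 := by
      rw [← sq, WithLp.prod_norm_sq_eq_of_L2]
      rfl
    have hx := inner_volterra_add (T z) (W z)
    rw [hT, inner_zero_left, real_inner_comm (W z) (volterra 𝕜 P.L (T z))] at hx
    have e1 : 0 ≤ l⁻¹ * inner ℝ (mulP 𝕜 hP (W z)) (W z) :=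
      mul_nonneg (by positivity) ((by positivity : 0 ≤ p₀ * ‖W z‖ ^ 2).trans (hp _))
    have e2 : d₀ * ‖W z‖ ^ 2 ≤ inner ℝ (mulD 𝕜 hP (W z)) (W z) := hd _
    have e3 : 0 ≤ l * inner ℝ (mulM 𝕜 hP (J (W z))) (J (W z)) :=
      mul_nonneg hl.le ((by positivity : 0 ≤ m₀ * ‖J (W z)‖ ^ 2).trans (hm _))
    have e4 : 0 ≤ l * inner ℝ (J (T z)) (J (T z)) := mul_nonneg hl.le real_inner_self_nonneg
    have e5 : P.η * inner ℝ (T z) (J (W z)) + P.η * inner ℝ (W z) (J (T z)) = 0 := by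
      rw [← mul_add, hx, mul_zero]
    have e6 := mul_le_mul_of_nonneg_right (min_le_left (2 * d₀) r) (sq_nonneg ‖W z‖)
    have e7 := mul_le_mul_of_nonneg_right (min_le_right (2 * d₀) r) (sq_nonneg ‖T z‖)
    rw [mul_assoc, hn, hBa, real_inner_self_eq_norm_sq (T z)]
    linarith
  let ℓ : V →L[ℝ] ℝ := innerSL ℝ h₁ ∘L J ∘L W + innerSL ℝ h₂ ∘L W
    + (innerSL ℝ h₃ ∘L J ∘L T + innerSL ℝ h₄ ∘L T)
  have hℓ : ∀ y : V, ℓ y = inner ℝ h₁ (J (W y)) + inner ℝ h₂ (W y)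
    + (inner ℝ h₃ (J (T y)) + inner ℝ h₄ (T y)) := fun y => rfl
  obtain ⟨z, hz⟩ := exists_eq_of_isCoercive hcoer ℓ
  refine ⟨ofDeriv hL (W z) (hW z), ofDeriv hL (T z) (hT z), fun φ => ?_, fun φ => ?_⟩
  · have h := hz (WithLp.toLp 2 (⟨dx φ, mean_dx hL φ⟩, 0))
    rw [hBa, hℓ] at h
    have hw : W (WithLp.toLp 2 ((⟨dx φ, mean_dx hL φ⟩ : MeanZero 𝕜 P.L), 0)) = dx φ := rfl
    have ht : T (WithLp.toLp 2 ((⟨dx φ, mean_dx hL φ⟩ : MeanZero 𝕜 P.L), 0)) = 0 := rfl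
    have hj : J (dx φ) = fn φ := (fn_eq_volterra hL φ).symm
    simp only [hw, ht, hj, map_zero, inner_zero_right, mul_zero, add_zero] at h
    exact h
  · have h := hz (WithLp.toLp 2 (0, ⟨dx φ, mean_dx hL φ⟩))
    rw [hBa, hℓ] at h
    have hw : W (WithLp.toLp 2 (0, (⟨dx φ, mean_dx hL φ⟩ : MeanZero 𝕜 P.L))) = 0 := rfl
    have ht : T (WithLp.toLp 2 (0, (⟨dx φ, mean_dx hL φ⟩ : MeanZero 𝕜 P.L))) = dx φ := rfl
    have hj : J (dx φ) = fn φ := (fn_eq_volterra hL φ).symm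
    simp only [hw, ht, hj, map_zero, inner_zero_right, mul_zero, zero_add] at h
    exact h

theorem exists_isImage_resolvent (hP : P.Admissible) {l : ℝ} (hl : 0 < l) (F : Phase 𝕜 P.L) :
    ∃ U G : Phase 𝕜 P.L, IsImage P U G ∧ l • U - G = F := by
  obtain ⟨f₁, f₂, f₃, f₄⟩ := F
  have hτ := hP.τ_pos
  have hβ := hP.β_pos
  have hκ := hP.κ_pos
  have hs : 0 < l * P.τ + P.β := by positivity
  -- The last resolvent equation gives `q = s (τ f₄ - κ θ_x)`, and the first gives `u = (w + f₁) /
  -- l`. Substituting `q` into the heat equation produces the diffusion coefficient `r = κ² s`.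
  set s := (l * P.τ + P.β)⁻¹ with hs'
  have hss : s * (l * P.τ + P.β) = 1 := inv_mul_cancel₀ hs.ne'
  obtain ⟨w, t, hw, ht⟩ := exists_weak_solution hP hl (r := P.κ ^ 2 * s) (by positivity)
    (mulM 𝕜 hP f₂) (-(l⁻¹ • mulP 𝕜 hP (dx f₁))) f₃ ((P.κ * s * P.τ) • f₄)
  let q : L2 𝕜 P.L := s • (P.τ • f₄ - P.κ • dx t)
  refine ⟨(l⁻¹ • (w + f₁), fn w, fn t, q), (w, l • fn w - f₂, l • fn t - f₃, l • q - f₄), ?_, ?_⟩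
  · rw [isImage_iff hP]
    refine ⟨rfl, t, rfl, fun φ => ?_, fun φ => ?_, ?_⟩
    · have h := hw φ
      simp only [dx_smul, dx_add, map_add, map_sub, map_smul, inner_add_right, inner_sub_right,
        inner_smul_right, inner_neg_left, inner_smul_left, RCLike.conj_to_real] at h ⊢
      simp only [real_inner_comm] at h ⊢
      linear_combination h
    · have h := ht φ
      simp only [q, inner_add_right, inner_sub_right, inner_smul_right, inner_smul_left,
        RCLike.conj_to_real] at h ⊢
      simp only [real_inner_comm] at h ⊢
      linear_combination -h
    · have h : (l * P.τ + P.β) • q = P.τ • f₄ - P.κ • dx t := by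
        rw [smul_smul, mul_comm, hss, one_smul]
      have h' : P.τ • (l • q) + P.β • q = P.τ • f₄ - P.κ • dx t := by
        rw [← h, add_smul, smul_smul, mul_comm P.τ l]
      rw [smul_sub, eq_sub_of_add_eq h']
      abel
  · have e1 : l • (l⁻¹ • (w + f₁)) - w = f₁ := by
      rw [smul_inv_smul₀ hl.ne', add_sub_cancel_left]
    have e : ∀ a b : L2 𝕜 P.L, l • a - (l • a - b) = b := fun a b => sub_sub_cancel _ _
    exact Prod.ext e1 (Prod.ext (e _ _) (Prod.ext (e _ _) (e _ _)))

end Resolvent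

/-! ### Control of the energy by two dissipations -/

section Decay

variable {𝕜 : Type*} [RCLike 𝕜] {P : Params}

theorem add_four_sq_le (a b c d : ℝ) :
    (a + b + c + d) ^ 2 ≤ 4 * (a ^ 2 + b ^ 2 + c ^ 2 + d ^ 2) := by
  linarith [sq_nonneg (a - b), sq_nonneg (a - c), sq_nonneg (a - d), sq_nonneg (b - c),
    sq_nonneg (b - d), sq_nonneg (c - d)]

set_option maxHeartbeats 400000 in
/-- The dissipation of a state and of its image together control the energy of the state. -/
theorem exists_energy_le_dissipation (𝕜 : Type*) [RCLike 𝕜] (hP : P.Admissible) :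
    ∃ C : ℝ, 0 < C ∧ ∀ X Y Z : Phase 𝕜 P.L, IsImage P X Y → IsImage P Y Z →
      ‖energyMap 𝕜 hP X‖ ^ 2
        ≤ C * (-(2 * inner ℝ (energyMap 𝕜 hP X) (energyMap 𝕜 hP Y))
          - 2 * inner ℝ (energyMap 𝕜 hP Y) (energyMap 𝕜 hP Z)) := by
  have hL := hP.L_pos
  have hτ := hP.τ_pos
  have hβ := hP.β_pos
  have hκ := hP.κ_pos
  have hη := hP.η_pos
  obtain ⟨d₀, hd₀, hd⟩ := exists_le_inner_mulOp (𝕜 := 𝕜) hP.δ_reg.1 hL hP.δ_pos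
  obtain ⟨p₀, hp₀, hp⟩ := exists_le_inner_mulOp (𝕜 := 𝕜) hP.p_reg.1 hL hP.p_pos
  obtain ⟨j, hj0, hj⟩ : ∃ j : ℝ, 0 ≤ j ∧ ∀ u : H10 𝕜 P.L, ‖fn u‖ ≤ j * ‖dx u‖ :=
    ⟨_, ContinuousLinearMap.opNorm_nonneg _, norm_fn_le hL⟩
  obtain ⟨cp, hcp0, hcp⟩ : ∃ c : ℝ, 0 ≤ c ∧ ∀ f : L2 𝕜 P.L, ‖mulP 𝕜 hP f‖ ≤ c * ‖f‖ :=
    ⟨_, ContinuousLinearMap.opNorm_nonneg _, (mulP 𝕜 hP).le_opNorm⟩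
  obtain ⟨cm, hcm0, hcm⟩ : ∃ c : ℝ, 0 ≤ c ∧ ∀ f : L2 𝕜 P.L, ‖mulM 𝕜 hP f‖ ≤ c * ‖f‖ :=
    ⟨_, ContinuousLinearMap.opNorm_nonneg _, (mulM 𝕜 hP).le_opNorm⟩
  obtain ⟨cd, hcd0, hcd⟩ : ∃ c : ℝ, 0 ≤ c ∧ ∀ f : L2 𝕜 P.L, ‖mulD 𝕜 hP f‖ ≤ c * ‖f‖ :=
    ⟨_, ContinuousLinearMap.opNorm_nonneg _, (mulD 𝕜 hP).le_opNorm⟩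
  -- With `N` the sum of the norms of `w_x`, `w_tx`, `q` and `q_t`, these constants give `‖θ_x‖ ≤ g
  -- N`, `‖u_x‖ ≤ k N` and `‖energyMap X‖² ≤ M N²`. The dissipations bound the sum of the four
  -- squares with constant `e`, and the factor `4` in `4 * M / e` comes from `N²`.
  set g := (P.τ + P.β) / P.κ with hg
  have hg0 : 0 ≤ g := by positivity
  set k := (2 * cd + j * cm * j + P.η * j * g) / p₀ with hk
  have hk0 : 0 ≤ k := by positivity
  set M := cp * k ^ 2 + cm * j ^ 2 + (j * g) ^ 2 + P.τ with hM
  have hM0 : 0 < M := by positivity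
  obtain ⟨e, he, hed, heβ⟩ : ∃ e : ℝ, 0 < e ∧ e ≤ 4 * d₀ ∧ e ≤ 2 * P.β :=
    ⟨min (4 * d₀) (2 * P.β), by simp [hd₀, hβ], min_le_left _ _, min_le_right _ _⟩
  refine ⟨4 * M / e, by positivity, ?_⟩
  rintro ⟨u, w, θ, q⟩ ⟨y₁, y₂, y₃, y₄⟩ ⟨z₁, z₂, z₃, z₄⟩ hXY hYZ
  rw [inner_energyMap_of_isImage hP hXY, inner_energyMap_of_isImage hP hYZ]
  rw [isImage_iff hP] at hXY hYZ
  obtain ⟨rfl, t, rfl, h3, -, h5⟩ := hXY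
  obtain ⟨rfl, -⟩ := hYZ
  set a := ‖dx u‖ with ha
  set b := ‖dx y₁‖ with hb
  set b' := ‖dx z₁‖ with hb'
  set v := ‖q‖ with hv
  set v' := ‖y₄‖ with hv'
  have ha0 : 0 ≤ a := norm_nonneg _
  have hb0 : 0 ≤ b := norm_nonneg _
  have hb'0 : 0 ≤ b' := norm_nonneg _
  have hv0 : 0 ≤ v := norm_nonneg _
  have hv'0 : 0 ≤ v' := norm_nonneg _
  set N := b + b' + v + v' with hN
  have hN0 : 0 ≤ N := by positivity
  have ht : ‖dx t‖ ≤ g * N := by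
    have h : P.κ • dx t = -(P.τ • y₄) - P.β • q := by
      rw [h5]; abel
    have h' : P.κ * ‖dx t‖ ≤ P.τ * v' + P.β * v := by
      rw [← Real.norm_of_nonneg hκ.le, ← norm_smul, h]
      refine (norm_sub_le _ _).trans ?_
      rw [norm_neg, norm_smul, norm_smul, Real.norm_of_nonneg hτ.le, Real.norm_of_nonneg hβ.le]
    rw [hg, div_mul_eq_mul_div, le_div_iff₀ hκ]
    nlinarith [mul_nonneg hτ.le hb0, mul_nonneg hτ.le hb'0, mul_nonneg hτ.le hv0,
      mul_nonneg hβ.le hb0, mul_nonneg hβ.le hb'0, mul_nonneg hβ.le hv'0]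
  have hu : a ≤ k * N := by
    -- Testing with `u` itself gives `∫ p |u_x|²` on the left; one factor `a` is cancelled at the
    -- end.
    have h := h3 u
    simp only [inner_add_right, inner_smul_right] at h
    have e1 : p₀ * a ^ 2 ≤ inner ℝ (dx u) (mulP 𝕜 hP (dx u)) := by
      rw [real_inner_comm]
      exact hp (dx u)
    have e2 : |inner ℝ (dx u) (mulD 𝕜 hP (dx y₁))| ≤ a * (cd * b) :=
      (abs_real_inner_le_norm _ _).trans (mul_le_mul_of_nonneg_left (hcd _) ha0)
    have e3 : |inner ℝ (fn u) (mulM 𝕜 hP (fn z₁))| ≤ (j * a) * (cm * (j * b')) :=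
      (abs_real_inner_le_norm _ _).trans (mul_le_mul (hj u)
        ((hcm _).trans (mul_le_mul_of_nonneg_left (hj z₁) hcm0)) (norm_nonneg _) (by positivity))
    have e4 : |inner ℝ (fn u) (dx t)| ≤ (j * a) * (g * N) :=
      (abs_real_inner_le_norm _ _).trans (mul_le_mul (hj u) ht (norm_nonneg _) (by positivity))
    have e4' := mul_le_mul_of_nonneg_left (neg_le_of_abs_le e4) hη.le
    have e5 : p₀ * a ^ 2
        ≤ 2 * (a * (cd * b)) + (j * a) * (cm * (j * b')) + P.η * ((j * a) * (g * N)) := by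
      linarith [neg_le_of_abs_le e2, neg_le_of_abs_le e3]
    have e6 : p₀ * a ^ 2 ≤ a * ((2 * cd + j * cm * j + P.η * j * g) * N) := by
      have hbN : b ≤ N := by rw [hN]; linarith
      have hbN' : b' ≤ N := by rw [hN]; linarith
      have f1 := mul_le_mul_of_nonneg_left hbN (by positivity : 0 ≤ 2 * a * cd)
      have f2 := mul_le_mul_of_nonneg_left hbN' (by positivity : 0 ≤ j * a * cm * j)
      linarith
    rw [hk, div_mul_eq_mul_div, le_div_iff₀ hp₀]
    rcases ha0.eq_or_lt with h0 | h0
    · rw [← h0, zero_mul]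
      positivity
    · refine le_of_mul_le_mul_left ?_ h0
      linarith
  have hE : ‖energyMap 𝕜 hP (u, fn y₁, fn t, q)‖ ^ 2 ≤ M * N ^ 2 := by
    rw [← real_inner_self_eq_norm_sq (energyMap 𝕜 hP _), inner_energyMap,
      real_inner_self_eq_norm_sq, real_inner_self_eq_norm_sq]
    have f1 : inner ℝ (mulP 𝕜 hP (dx u)) (dx u) ≤ cp * (k * N) ^ 2 := by
      refine (real_inner_le_norm _ _).trans ?_
      calc ‖mulP 𝕜 hP (dx u)‖ * a ≤ (cp * a) * a := mul_le_mul_of_nonneg_right (hcp _) ha0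
        _ = cp * a ^ 2 := by ring
        _ ≤ _ := by gcongr
    have f2 : inner ℝ (mulM 𝕜 hP (fn y₁)) (fn y₁) ≤ cm * (j * N) ^ 2 := by
      refine (real_inner_le_norm _ _).trans ?_
      have hw : ‖fn y₁‖ ≤ j * N := (hj y₁).trans (by gcongr; rw [hN]; linarith)
      calc ‖mulM 𝕜 hP (fn y₁)‖ * ‖fn y₁‖ ≤ (cm * ‖fn y₁‖) * ‖fn y₁‖ :=
            mul_le_mul_of_nonneg_right (hcm _) (norm_nonneg _)
        _ = cm * ‖fn y₁‖ ^ 2 := by ring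
        _ ≤ _ := by gcongr
    have f3 : ‖fn t‖ ^ 2 ≤ (j * (g * N)) ^ 2 := by
      have := (hj t).trans (mul_le_mul_of_nonneg_left ht hj0)
      gcongr
    have f4 : P.τ * ‖q‖ ^ 2 ≤ P.τ * N ^ 2 := by
      have : ‖q‖ ≤ N := by rw [hN]; linarith
      gcongr
    have f5 : M * N ^ 2 = cp * (k * N) ^ 2 + cm * (j * N) ^ 2 + (j * (g * N)) ^ 2
        + P.τ * N ^ 2 := by rw [hM]; ring
    rw [f5]
    linarith
  have hN2 : N ^ 2 ≤ 4 * (b ^ 2 + b' ^ 2 + v ^ 2 + v' ^ 2) := by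
    exact add_four_sq_le b b' v v'
  have hD : e * (b ^ 2 + b' ^ 2 + v ^ 2 + v' ^ 2)
      ≤ -(2 * (-(2 * inner ℝ (mulD 𝕜 hP (dx y₁)) (dx y₁)) - P.β * v ^ 2))
        - 2 * (-(2 * inner ℝ (mulD 𝕜 hP (dx z₁)) (dx z₁)) - P.β * v' ^ 2) := by
    have g1 : d₀ * b ^ 2 ≤ inner ℝ (mulD 𝕜 hP (dx y₁)) (dx y₁) := hd _
    have g2 : d₀ * b' ^ 2 ≤ inner ℝ (mulD 𝕜 hP (dx z₁)) (dx z₁) := hd _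
    have g3 := mul_le_mul_of_nonneg_right hed (sq_nonneg b)
    have g4 := mul_le_mul_of_nonneg_right hed (sq_nonneg b')
    have g5 := mul_le_mul_of_nonneg_right heβ (sq_nonneg v)
    have g6 := mul_le_mul_of_nonneg_right heβ (sq_nonneg v')
    linarith
  calc _ ≤ M * N ^ 2 := hE
    _ ≤ M * (4 * (b ^ 2 + b' ^ 2 + v ^ 2 + v' ^ 2)) := by gcongr
    _ = 4 * M / e * (e * (b ^ 2 + b' ^ 2 + v ^ 2 + v' ^ 2)) := by field_simp
    _ ≤ _ := mul_le_mul_of_nonneg_left hD (by positivity)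

end Decay

/-! ### Time regularity of orbits -/

section Regularity

variable {𝕜 : Type*} [RCLike 𝕜] {P : Params} {S : ℝ → Phase 𝕜 P.L → Phase 𝕜 P.L}

theorem contDiffOn_orbit (hcont : ∀ x, Continuous fun t => S t x)
    (hder : ∀ x y, IsImage P x y → ∀ t, 0 ≤ t →
      HasDerivWithinAt (fun s => S s x) (S t y) (Ici 0) t) :
    ∀ (n : ℕ) (x : Phase 𝕜 P.L), MemDomPow P n x → ContDiffOn ℝ n (fun t => S t x) (Ici 0)
  | 0, x, _ => by
    rw [Nat.cast_zero, contDiffOn_zero]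
    exact (hcont x).continuousOn
  | n + 1, x, ⟨y, hxy, hy⟩ => by
    have hu : UniqueDiffOn ℝ (Ici (0 : ℝ)) := uniqueDiffOn_Ici 0
    rw [Nat.cast_add, Nat.cast_one, contDiffOn_succ_iff_derivWithin hu]
    refine ⟨fun t ht => (hder x y hxy t ht).differentiableWithinAt, fun h => by simp at h, ?_⟩
    exact (contDiffOn_orbit hcont hder n y hy).congr fun t ht =>
      (hder x y hxy t ht).derivWithin (hu t ht)

/-- The element `y` produced is `𝒜ᵏ x`: each time derivative of an orbit is the orbit of the image
under `𝒜`, which costs one power of the domain. -/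
theorem exists_iteratedDerivWithin_orbit
    (hder : ∀ x y, IsImage P x y → ∀ t, 0 ≤ t →
      HasDerivWithinAt (fun s => S s x) (S t y) (Ici 0) t) (j : ℕ) :
    ∀ (k : ℕ) (x : Phase 𝕜 P.L), MemDomPow P (j + k) x → ∃ y, MemDomPow P j y ∧
      EqOn (iteratedDerivWithin k (fun t => S t x) (Ici 0)) (fun t => S t y) (Ici 0)
  | 0, x, h => ⟨x, h, fun t _ => by rw [iteratedDerivWithin_zero]⟩
  | k + 1, x, ⟨y, hxy, hy⟩ => by
    obtain ⟨z, hz, hEq⟩ := exists_iteratedDerivWithin_orbit hder j k y hy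
    refine ⟨z, hz, fun t ht => ?_⟩
    rw [← hEq ht, iteratedDerivWithin_succ']
    exact iteratedDerivWithin_congr (fun s hs =>
      (hder x y hxy s hs).derivWithin (uniqueDiffOn_Ici 0 s hs)) ht

end Regularity

end Cattaneo

end

theorem theorem3p1 {𝕜 : Type*} [RCLike 𝕜] (P : Cattaneo.Params) (hP : P.Admissible) :
    ∃ C : ℝ, 0 < C ∧
      ∀ n : ℕ, 1 ≤ n → ∀ U₀ : Cattaneo.Phase 𝕜 P.L, Cattaneo.MemDomPow P (n + 1) U₀ →
        ∃ U : ℝ → Cattaneo.Phase 𝕜 P.L,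
          Cattaneo.IsStrongSolution P U₀ U ∧
          (∀ V : ℝ → Cattaneo.Phase 𝕜 P.L,
            Cattaneo.IsStrongSolution P U₀ V → Set.EqOn V U (Set.Ici 0)) ∧
          ContDiffOn ℝ (n + 1) U (Set.Ici 0) ∧
          ∀ t : ℝ, 0 < t →
            Cattaneo.energy P n U t
              ≤ C * (Cattaneo.energy P n U 0 + Cattaneo.energy P (n + 1) U 0) / t := by
  have : CompleteSpace (Cattaneo.H10 𝕜 P.L) := Cattaneo.completeSpace_H10 hP.L_pos
  obtain ⟨c, hc⟩ := Cattaneo.exists_norm_le_energyMap (𝕜 := 𝕜) hP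
  obtain ⟨S, hS0, hcont, hS⟩ := Cattaneo.exists_semigroup_of_embedding (Cattaneo.energyMap 𝕜 hP) hc
    (Cattaneo.opGraph 𝕜 hP) (fun x y h => Cattaneo.inner_energyMap_nonpos hP h)
    (fun y h => Cattaneo.isImage_zero_left hP h)
    (fun l hl f => Cattaneo.exists_isImage_resolvent hP hl f)
  have hder : ∀ x y, Cattaneo.IsImage P x y → ∀ t, 0 ≤ t →
      HasDerivWithinAt (fun s => S s x) (S t y) (Set.Ici 0) t := fun x y h t ht =>
    (hS x y h t ht).2
  have hinj : Function.Injective (Cattaneo.energyMap 𝕜 hP) := by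
    rw [injective_iff_map_eq_zero]
    intro x hx
    have := hc x
    rw [hx, norm_zero, mul_zero] at this
    exact norm_le_zero_iff.mp this
  have hu : UniqueDiffOn ℝ (Set.Ici (0 : ℝ)) := uniqueDiffOn_Ici 0
  obtain ⟨C, hC0, hC⟩ := Cattaneo.exists_energy_le_dissipation 𝕜 hP
  refine ⟨C, hC0, fun n hn U₀ hU₀ => ⟨fun t => S t U₀, ?_, ?_, ?_, ?_⟩⟩
  · obtain ⟨F, hF, -⟩ := hU₀
    refine ⟨hS0 U₀, ?_, fun t ht => ?_⟩
    · have := Cattaneo.contDiffOn_orbit hcont hder 1 U₀ ⟨F, hF, trivial⟩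
      exact_mod_cast this
    · rw [(hder U₀ F hF t ht).derivWithin (hu t ht)]
      exact (hS U₀ F hF t ht).1
  · intro V hV
    obtain ⟨F, hF, -⟩ := hU₀
    refine Cattaneo.eqOn_of_dissipative (Cattaneo.energyMap 𝕜 hP) hinj (Cattaneo.opGraph 𝕜 hP)
      (fun x y h => Cattaneo.inner_energyMap_nonpos hP h)
      (f' := derivWithin V (Set.Ici 0)) (g' := fun t => S t F)
      (fun t ht => ⟨hV.eqn t ht, ?_⟩) (fun t ht => hS U₀ F hF t ht) ?_
    · exact ((hV.contDiffOn.differentiableOn (by simp)) t ht).hasDerivWithinAt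
    · rw [hV.init, hS0]
  · exact_mod_cast Cattaneo.contDiffOn_orbit hcont hder (n + 1) U₀ hU₀
  · intro t ht
    obtain ⟨k, rfl⟩ : ∃ k, n = k + 1 := ⟨n - 1, by omega⟩
    -- The energy of order `n = k + 1` involves `k` time derivatives, which leaves two powers of the
    -- domain for `x = 𝒜ᵏ U₀`, just enough for `y = 𝒜 x` and `z = 𝒜 y`.
    have hdom : Cattaneo.MemDomPow P (2 + k) U₀ := by
      rwa [show 2 + k = k + 1 + 1 by ring]
    obtain ⟨x, ⟨y, hxy, z, hyz, -⟩, hx⟩ :=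
      Cattaneo.exists_iteratedDerivWithin_orbit hder 2 k U₀ hdom
    have hy : iteratedDerivWithin (k + 1) (fun s => S s U₀) (Set.Ici 0) 0 = y := by
      rw [iteratedDerivWithin_succ, derivWithin_congr hx (hx Set.self_mem_Ici),
        (hder x y hxy 0 le_rfl).derivWithin (hu 0 Set.self_mem_Ici), hS0]
    have h := Cattaneo.mul_norm_sq_le_of_dissipation (Cattaneo.energyMap 𝕜 hP) (C := C)
      (x := fun s => S s x) (y := fun s => S s y) (z := fun s => S s z)
      (hder x y hxy) (hder y z hyz)
      (fun s hs => Cattaneo.inner_energyMap_nonpos hP (hS x y hxy s hs).1)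
      (fun s hs => hC _ _ _ (hS x y hxy s hs).1 (hS y z hyz s hs).1) hC0.le ht.le
    simp only [hS0] at h
    simp only [Cattaneo.energy, Nat.add_sub_cancel]
    rw [hx (show t ∈ Set.Ici (0 : ℝ) from ht.le), hx Set.self_mem_Ici, hy]
    simp only [hS0]
    rw [Cattaneo.stateEnergy_eq hP, Cattaneo.stateEnergy_eq hP, Cattaneo.stateEnergy_eq hP,
      le_div_iff₀ ht]
    linarith
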